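/- Let $(\Omega,\mathcal F)$ be a measurable space and $\mathcal H$ a set of real random variables on it which contains the indicators $I_A$, $A\in\mathcal F$, and is closed under $(X_1,\dots,X_n)\mapsto\varphi(X_1,\dots,X_n)$ for all $\varphi:\mathbb R^n\to\mathbb R$ satisfying $|\varphi(x)-\varphi(y)|\le C(1+|x|^m+|y|^m)|x-y|$ for some $C>0$, $m\in\mathbb N$. Let $\mathbb E:\mathcal H\to[-\infty,\infty]$ be a sublinear expectation: monotone, with $\mathbb E[c]=c$ for $c\in\mathbb R$, $\mathbb E[\lambda X]=\lambda\mathbb E[X]$ for $\lambda\ge0$, and $\mathbb E[X+Y]\le\mathbb E[X]+\mathbb E[Y]$ whenever the right side is not of the form $\infty-\infty$ or $-\infty+\infty$. Assume that $\mathbb E$ is countably sub-additive: $\mathbb E[X]\le\sum_{n\ge1}\mathbb E[X_n]$ whenever $0\le X\le\sum_{n\ge1}X_n$ with $X,X_n\in\mathcal H$, $X_n\ge0$. Let $V(A)=\inf\{\mathbb E[\xi]: I_A\le\xi,\ \xi\in\mathcal H\}$ and $$C_V(X)=\int_0^\infty V(X>x)\,dx+\int_{-\infty}^0\bigl(V(X>x)-1\bigr)\,dx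 .$$ A random vector $Y$ with entries in $\mathcal H$ is independent of a random vector $X$ with entries in $\mathcal H$ if $\mathbb E[\psi(X,Y)]=\mathbb E\bigl[\mathbb E[\psi(x,Y)]|_{x=X}\bigr]$ for every Borel function $\psi$ with $\psi(X,Y)\in\mathcal H$, $\psi(x,Y)\in\mathcal H$ and $\bar\psi(x):=\mathbb E|\psi(x,Y)|<\infty$ for all $x$, and $\mathbb E[\bar\psi(X)]<\infty$ (where $\bar\psi(X)$ and $\mathbb E[\psi(x,Y)]|_{x=X}$ are required to lie in $\mathcal H$). The random variables $X_1,X_2,\dots$ are independent if $X_{n+1}$ is independent of $(X_1,\dots,X_n)$ for every $n\ge1$. Two random variables $X,Y\in\mathcal H$ are identically distributed if $\mathbb E[\psi(X)]=\mathbb E[\psi(Y)]$ for every Borel function $\psi$ with $\psi(X),\psi(Y)\in\mathcal H$ for which both expectations are finite. **Theorem.** Let $\beta>-1$ and $r>1$. Let $X_1,X_2,\ldots\in\mathcal H$ be independent and each identically distributed as $X\in\mathcal H$, with $\mathbb E[X_i]=-\mathbb E[-X_i]=0$ for all $i\ge1$. Let $a_{ni}>0$ $(1\le i\le n,\ n\ge1)$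 satisfy $\sum_{i=1}^n a_{ni}=1$ for all $n\ge1$ and $a_{ni}\approx (i/n)^\beta\frac1n$, that is, there are constants $0<c\le C<\infty$ with $c\,(i/n)^\beta\frac1n\le a_{ni}\le C\,(i/n)^\beta\frac1n$ for all sufficiently large $n$ and all $1\le i\le n$. Suppose that $$\begin{cases} C_V\bigl(|X|^{(r-1)/(1+\beta)}\bigr)<\infty & \text{if } -1<\beta<-1/r,\\ C_V\bigl(|X|^{r}\ln(1+|X|)\bigr)<\infty & \text{if } \beta=-1/r,\\ C_V\bigl(|X|^{r}\bigr)<\infty & \text{if } \beta>-1/r.\end{cases}\tag{1}$$ Then for all $\varepsilon>0$ $$\sum_{n=1}^\infty n^{r-2}\,\mathbb E\Bigl[\Bigl(\max_{1\le j\le n}\Bigl|\sum_{i=1}^j a_{ni}X_i\Bigr|-\varepsilon\Bigr)^+\Bigr]<\infty,\tag{2}$$ $$\sum_{n=1}^\infty n^{r-2}\,V\Bigl(\max_{1\le j\le n}\Bigl|\sum_{i=1}^j a_{ni}X_i\Bigr|>\varepsilon\Bigr)<\infty.\tag{3}$$ Conversely, if (2) holds for all $\varepsilon>0$, then (1) holds.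 -/

import Mathlib

open MeasureTheory Filter
open scoped ENNReal

noncomputable section

/-- The class `C_{l,Lip}(ℝⁿ)`: functions `φ` with
`|φ x - φ y| ≤ C (1 + |x|^m + |y|^m) |x - y|` for some `C > 0`, `m ∈ ℕ`.
All norms on `ℝⁿ` give the same class. -/
def LocLip {n : ℕ} (φ : (Fin n → ℝ) → ℝ) : Prop :=
  ∃ C : ℝ, 0 < C ∧ ∃ m : ℕ, ∀ x y : Fin n → ℝ,
    |φ x - φ y| ≤ C * (1 + ‖x‖ ^ m + ‖y‖ ^ m) * ‖x - y‖

/-- A sublinear expectation space `(Ω, H, E)`. The functional `E` is an extended-real valued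
functional on `H`; it is written as a total function, but nothing is assumed about (and nothing
depends on) its values outside `H`. -/
structure SublinearExpectationSpace (Ω : Type*) [MeasurableSpace Ω] where
  /-- the space of random variables -/
  H : Set (Ω → ℝ)
  /-- the sublinear expectation -/
  E : (Ω → ℝ) → EReal
  measurable_of_mem : ∀ X ∈ H, Measurable X
  indicator_mem : ∀ A : Set Ω, MeasurableSet A → A.indicator (fun _ => (1 : ℝ)) ∈ H
  comp_mem : ∀ (n : ℕ) (X : Fin n → Ω → ℝ) (φ : (Fin n → ℝ) → ℝ),
    (∀ i, X i ∈ H) → LocLip φ → (fun ω => φ (fun i => X i ω)) ∈ H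
  mono : ∀ X ∈ H, ∀ Y ∈ H, (∀ ω, Y ω ≤ X ω) → E Y ≤ E X
  const : ∀ c : ℝ, E (fun _ => c) = (c : EReal)
  pos_homog : ∀ c : ℝ, 0 ≤ c → ∀ X ∈ H, E (fun ω => c * X ω) = (c : EReal) * E X
  subadd : ∀ X ∈ H, ∀ Y ∈ H, ¬ (E X = ⊤ ∧ E Y = ⊥) → ¬ (E X = ⊥ ∧ E Y = ⊤) →
    E (fun ω => X ω + Y ω) ≤ E X + E Y

namespace SublinearExpectationSpace

variable {Ω : Type*} [MeasurableSpace Ω]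

/-- Countable sub-additivity: `E X ≤ ∑ E Xₙ` whenever `X ≤ ∑ Xₙ` pointwise, with `X ≥ 0` and all
`Xₙ ≥ 0` in `H`. All quantities are nonnegative, so the sums are taken in `[0, ∞]`. -/
def CountablySubadditive (S : SublinearExpectationSpace Ω) : Prop :=
  ∀ (X : Ω → ℝ) (Y : ℕ → Ω → ℝ), X ∈ S.H → (∀ n, Y n ∈ S.H) →
    (∀ ω, 0 ≤ X ω) → (∀ n ω, 0 ≤ Y n ω) →
    (∀ ω, ENNReal.ofReal (X ω) ≤ ∑' n, ENNReal.ofReal (Y n ω)) →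
    (S.E X).toENNReal ≤ ∑' n, (S.E (Y n)).toENNReal

/-- The capacity `V(A) = inf {E ξ : I_A ≤ ξ, ξ ∈ H}`. -/
def capacity (S : SublinearExpectationSpace Ω) (A : Set Ω) : EReal :=
  sInf {v : EReal | ∃ ξ ∈ S.H, (∀ ω, A.indicator (fun _ => (1 : ℝ)) ω ≤ ξ ω) ∧ v = S.E ξ}

/-- The Choquet expectation
`C_V(X) = ∫_0^∞ V(X > x) dx + ∫_{-∞}^0 (V(X > x) - 1) dx`; both integrands have constant sign,
the second one is written as minus the integral of `1 - V(X > x) ≥ 0`. -/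
def choquet (S : SublinearExpectationSpace Ω) (X : Ω → ℝ) : EReal :=
  ((∫⁻ x in Set.Ioi (0 : ℝ), (S.capacity {ω | x < X ω}).toENNReal : ℝ≥0∞) : EReal) -
    ((∫⁻ x in Set.Iio (0 : ℝ), (1 - S.capacity {ω | x < X ω}).toENNReal : ℝ≥0∞) : EReal)

/-- `Y` is independent of `X`: for Borel `ψ`, `E[ψ(X, Y)] = E[E[ψ(x, Y)]|_{x = X}]` whenever
`ψ(X, Y)` and all `ψ(x, Y)` are in `H`, `ψ̄(x) = E|ψ(x, Y)| < ∞` for each `x` and `E[ψ̄(X)] < ∞`.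
For the two iterated expectations to be defined, the random variables `ψ̄(X)` and
`E[ψ(x, Y)]|_{x = X}` have to be in `H`; both are real valued because `ψ̄ < ∞`. -/
def Indep (S : SublinearExpectationSpace Ω) {α β : Type*} [MeasurableSpace α] [MeasurableSpace β]
    (X : Ω → α) (Y : Ω → β) : Prop :=
  ∀ ψ : α × β → ℝ, Measurable ψ →
    (fun ω => ψ (X ω, Y ω)) ∈ S.H →
    (∀ x, (fun ω => ψ (x, Y ω)) ∈ S.H) →
    (∀ x, S.E (fun ω => |ψ (x, Y ω)|) < ⊤) →
    (fun ω => (S.E (fun ω' => |ψ (X ω, Y ω')|)).toReal) ∈ S.H →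
    S.E (fun ω => (S.E (fun ω' => |ψ (X ω, Y ω')|)).toReal) < ⊤ →
    (fun ω => (S.E (fun ω' => ψ (X ω, Y ω'))).toReal) ∈ S.H →
    S.E (fun ω => ψ (X ω, Y ω)) = S.E (fun ω => (S.E (fun ω' => ψ (X ω, Y ω'))).toReal)

/-- The sequence `X₁, X₂, …` (the entry `X 0` is not used) is independent: `X_{n+1}` is
independent of `(X₁, …, Xₙ)` for every `n ≥ 1`. -/
def IndepSeq (S : SublinearExpectationSpace Ω) (X : ℕ → Ω → ℝ) : Prop :=
  ∀ n : ℕ, 1 ≤ n → S.Indep (fun ω (i : Fin n) => X ((i : ℕ) + 1) ω) (X (n + 1))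

/-- `X` and `Y` are identically distributed: `E[ψ(X)] = E[ψ(Y)]` for every Borel `ψ` with
`ψ(X), ψ(Y) ∈ H` for which both expectations are finite. -/
def IdentDistrib (S : SublinearExpectationSpace Ω) (X Y : Ω → ℝ) : Prop :=
  ∀ ψ : ℝ → ℝ, Measurable ψ → (fun ω => ψ (X ω)) ∈ S.H → (fun ω => ψ (Y ω)) ∈ S.H →
    S.E (fun ω => ψ (X ω)) ≠ ⊤ → S.E (fun ω => ψ (X ω)) ≠ ⊥ →
    S.E (fun ω => ψ (Y ω)) ≠ ⊤ → S.E (fun ω => ψ (Y ω)) ≠ ⊥ →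
    S.E (fun ω => ψ (X ω)) = S.E (fun ω => ψ (Y ω))

/-- The moment condition: `C_V(|X|^{(r-1)/(1+β)}) < ∞` if `β < -1/r`,
`C_V(|X|^r ln(1+|X|)) < ∞` if `β = -1/r`, and `C_V(|X|^r) < ∞` if `β > -1/r`. -/
def MomentCondition (S : SublinearExpectationSpace Ω) (β r : ℝ) (X : Ω → ℝ) : Prop :=
  (β < -1 / r → S.choquet (fun ω => |X ω| ^ ((r - 1) / (1 + β))) < ⊤) ∧
  (β = -1 / r → S.choquet (fun ω => |X ω| ^ r * Real.log (1 + |X ω|)) < ⊤) ∧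
  (-1 / r < β → S.choquet (fun ω => |X ω| ^ r) < ⊤)

end SublinearExpectationSpace

/-- `b_{ni} ≪ c_{ni}` for triangular arrays: for some `C > 0`, `b_{ni} ≤ C c_{ni}` for all large
`n` and all `1 ≤ i ≤ n`. -/
def ArrayLL (b c : ℕ → ℕ → ℝ) : Prop :=
  ∃ C : ℝ, 0 < C ∧ ∀ᶠ n : ℕ in atTop, ∀ i : ℕ, 1 ≤ i → i ≤ n → b n i ≤ C * c n i

/-- `b_{ni} ≈ c_{ni}`. -/
def ArrayApprox (b c : ℕ → ℕ → ℝ) : Prop :=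
  ArrayLL b c ∧ ArrayLL c b

/-- `max_{1 ≤ j ≤ n} |∑_{i=1}^j a_{ni} X_i|`. -/
def maxWeightedSum {Ω : Type*} (a : ℕ → ℕ → ℝ) (X : ℕ → Ω → ℝ) (n : ℕ+) (ω : Ω) : ℝ :=
  (Finset.Icc 1 (n : ℕ)).sup' (Finset.nonempty_Icc.mpr n.pos)
    (fun j => |∑ i ∈ Finset.Icc 1 j, a n i * X i ω|)

/-- `∑_{n ≥ 1} n^{r-2} E[(max_{1 ≤ j ≤ n} |∑_{i ≤ j} a_{ni} X_i| - ε)⁺]`, as an element of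
`[0, ∞]`. -/
def momentSeries {Ω : Type*} [MeasurableSpace Ω] (S : SublinearExpectationSpace Ω) (r : ℝ)
    (a : ℕ → ℕ → ℝ) (X : ℕ → Ω → ℝ) (ε : ℝ) : ℝ≥0∞ :=
  ∑' n : ℕ+, ENNReal.ofReal ((n : ℝ) ^ (r - 2)) *
    (S.E (fun ω => max (maxWeightedSum a X n ω - ε) 0)).toENNReal

/-- `∑_{n ≥ 1} n^{r-2} V(max_{1 ≤ j ≤ n} |∑_{i ≤ j} a_{ni} X_i| > ε)`, as an element of
`[0, ∞]`. -/
def capacitySeries {Ω : Type*} [MeasurableSpace Ω] (S : SublinearExpectationSpace Ω) (r : ℝ)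
    (a : ℕ → ℕ → ℝ) (X : ℕ → Ω → ℝ) (ε : ℝ) : ℝ≥0∞ :=
  ∑' n : ℕ+, ENNReal.ofReal ((n : ℝ) ^ (r - 2)) *
    (S.capacity {ω | ε < maxWeightedSum a X n ω}).toENNReal

end

/-!
The proof rests on the comparison `a n i ≍ 1 / wscale γ n i`, where `γ = 1 + β` and
`wscale γ n i = i (n / i)^γ`. The moment condition is equivalent to convergence of the double series
`∑ n, n^(r - 2) ∑ i ≤ n, V(|X| > b * wscale γ n i)` for some (or all) `b > 0`. Indeed the weights
`n^(r - 2)` of the pairs `i ≤ n` with `wscale γ n i ≤ t` add up to the order of `growth q r t`, with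
`q = (r - 1) / γ` (`tsum_pairWeight_le`, `growth_le_tsum_pairWeight`): summation over `n` gives
`t^q i^(r - 1 - q)`, and the three cases of the moment condition are the three possible orders of
`∑ i ≤ t, i^(r - 1 - q)`. A layer-cake argument (`tsum_tail_le_lintegral`, `lintegral_le_tsum_tail`)
transfers this to tails and Choquet integrals. It needs neither additivity nor continuity of the
capacity.

If the moment condition holds, the terms `a n i * X i` are truncated at `±δ`. The sum of the excesses
over `δ` is controlled by the double series. The truncated sums exceed `ε` with a capacity of order
`n^(-(r + 1))` by an exponential maximal inequality (`IndepSeq.exponential_maximal`), which comes from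
stopping an exponential product (`IndepSeq.maximal_prod`). The stopping rule needs no regularity,
since `H` contains all indicators and independence is assumed for Borel functions. The mean-zero
assumption on both sides makes the linear term of the exponential harmless. The capacity series
follows from the moment series by Markov's inequality.

Conversely, the moment series controls the capacity of the event that some `a n i * |X i|` with
`i ≤ n` is large. These capacities tend to zero (`eventually_exceedSet_le`), and then the product
formula for unions of independent events (`IndepSeq.nnE_ind_union`) bounds the sum of the single
capacities by twice the capacity of the union, which gives the double series.
-/

noncomputable section

/-! ### Random variables in `H` and the expectation of nonnegative ones -/

namespace SublinearExpectationSpace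

/-- The indicator of an event as a real random variable. -/
def ind {Ω : Type*} (A : Set Ω) : Ω → ℝ := A.indicator fun _ => 1

theorem ind_of_mem {Ω : Type*} {A : Set Ω} {ω : Ω} (h : ω ∈ A) : ind A ω = 1 :=
  Set.indicator_of_mem h _

theorem ind_of_notMem {Ω : Type*} {A : Set Ω} {ω : Ω} (h : ω ∉ A) : ind A ω = 0 :=
  Set.indicator_of_notMem h _

theorem ind_nonneg {Ω : Type*} (A : Set Ω) (ω : Ω) : 0 ≤ ind A ω :=
  Set.indicator_nonneg (fun _ _ => zero_le_one) ω

theorem ind_le_one {Ω : Type*} (A : Set Ω) (ω : Ω) : ind A ω ≤ 1 :=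
  Set.indicator_le_self' (fun _ _ => zero_le_one) ω

theorem ind_mono {Ω : Type*} {A B : Set Ω} (h : A ⊆ B) (ω : Ω) : ind A ω ≤ ind B ω :=
  Set.indicator_le_indicator_of_subset h (fun _ => zero_le_one) ω

variable {Ω : Type*} [MeasurableSpace Ω] {S : SublinearExpectationSpace Ω}

theorem const_mem (c : ℝ) : (fun _ : Ω => c) ∈ S.H :=
  S.comp_mem 0 (fun i => i.elim0) (fun _ => c) (fun i => i.elim0)
    ⟨1, one_pos, 0, fun x y => by simp only [sub_self, abs_zero]; positivity⟩

theorem comp_mem_one {X : Ω → ℝ} (hX : X ∈ S.H) {φ : ℝ → ℝ} {C : ℝ} (hC : 0 < C) (m : ℕ)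
    (h : ∀ x y, |φ x - φ y| ≤ C * (1 + |x| ^ m + |y| ^ m) * |x - y|) :
    (fun ω => φ (X ω)) ∈ S.H := by
  refine S.comp_mem 1 (fun _ => X) (fun x => φ (x 0)) (fun _ => hX) ⟨C, hC, m, fun x y => ?_⟩
  refine (h _ _).trans ?_
  have hx : |x 0| ≤ ‖x‖ := norm_le_pi_norm x 0
  have hy : |y 0| ≤ ‖y‖ := norm_le_pi_norm y 0
  have hxy : |x 0 - y 0| ≤ ‖x - y‖ := norm_le_pi_norm (x - y) 0
  gcongr

theorem comp_mem_of_lipschitz {X : Ω → ℝ} (hX : X ∈ S.H) {φ : ℝ → ℝ} {C : ℝ}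
    (h : ∀ x y, |φ x - φ y| ≤ C * |x - y|) : (fun ω => φ (X ω)) ∈ S.H := by
  refine comp_mem_one hX (C := max C 1) (by positivity) 0 fun x y => (h x y).trans ?_
  have h1 : C ≤ max C 1 := le_max_left _ _
  have h2 : 0 < max C 1 := by positivity
  have h3 := abs_nonneg (x - y)
  simp only [pow_zero]
  nlinarith [mul_nonneg h2.le h3]

theorem comp_mem_two {X Y : Ω → ℝ} (hX : X ∈ S.H) (hY : Y ∈ S.H) (φ : (Fin 2 → ℝ) → ℝ)
    (h : LocLip φ) : (fun ω => φ ![X ω, Y ω]) ∈ S.H := by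
  have := S.comp_mem 2 ![X, Y] φ (fun i => by fin_cases i <;> simpa) h
  convert this using 3 with ω
  ext i; fin_cases i <;> rfl

theorem add_mem {X Y : Ω → ℝ} (hX : X ∈ S.H) (hY : Y ∈ S.H) :
    (fun ω => X ω + Y ω) ∈ S.H := by
  refine comp_mem_two hX hY (fun x => x 0 + x 1) ⟨1, one_pos, 0, fun x y => ?_⟩
  have h0 : |x 0 - y 0| ≤ ‖x - y‖ := norm_le_pi_norm (x - y) 0
  have h1 : |x 1 - y 1| ≤ ‖x - y‖ := norm_le_pi_norm (x - y) 1
  have := abs_add_le (x 0 - y 0) (x 1 - y 1)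
  have h2 := norm_nonneg (x - y)
  rw [show x 0 + x 1 - (y 0 + y 1) = x 0 - y 0 + (x 1 - y 1) by ring]
  simp only [pow_zero]
  linarith

theorem mul_mem {X Y : Ω → ℝ} (hX : X ∈ S.H) (hY : Y ∈ S.H) :
    (fun ω => X ω * Y ω) ∈ S.H := by
  refine comp_mem_two hX hY (fun x => x 0 * x 1) ⟨1, one_pos, 1, fun x y => ?_⟩
  have h0 : |x 0 - y 0| ≤ ‖x - y‖ := norm_le_pi_norm (x - y) 0
  have h1 : |x 1 - y 1| ≤ ‖x - y‖ := norm_le_pi_norm (x - y) 1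
  have h2 : |x 0| ≤ ‖x‖ := norm_le_pi_norm x 0
  have h3 : |y 1| ≤ ‖y‖ := norm_le_pi_norm y 1
  have h4 := norm_nonneg (x - y)
  have key : |x 0 * (x 1 - y 1) + (x 0 - y 0) * y 1| ≤ ‖x‖ * ‖x - y‖ + ‖x - y‖ * ‖y‖ := by
    refine (abs_add_le _ _).trans ?_
    rw [abs_mul, abs_mul]
    gcongr
  rw [show x 0 * x 1 - y 0 * y 1 = x 0 * (x 1 - y 1) + (x 0 - y 0) * y 1 by ring]
  simp only [pow_one]
  linarith

theorem const_mul_mem {X : Ω → ℝ} (c : ℝ) (hX : X ∈ S.H) : (fun ω => c * X ω) ∈ S.H :=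
  mul_mem (const_mem c) hX

theorem neg_mem {X : Ω → ℝ} (hX : X ∈ S.H) : (fun ω => -X ω) ∈ S.H := by
  simpa using const_mul_mem (-1) hX

theorem sub_mem {X Y : Ω → ℝ} (hX : X ∈ S.H) (hY : Y ∈ S.H) :
    (fun ω => X ω - Y ω) ∈ S.H := by
  simpa [sub_eq_add_neg] using add_mem hX (neg_mem hY)

theorem abs_mem {X : Ω → ℝ} (hX : X ∈ S.H) : (fun ω => |X ω|) ∈ S.H :=
  comp_mem_of_lipschitz hX (φ := fun x => |x|) (C := 1)
    fun x y => by simpa using abs_abs_sub_abs_le x y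

theorem max_mem {X Y : Ω → ℝ} (hX : X ∈ S.H) (hY : Y ∈ S.H) :
    (fun ω => max (X ω) (Y ω)) ∈ S.H := by
  have := const_mul_mem (1 / 2) (add_mem (add_mem hX hY) (abs_mem (sub_mem hY hX)))
  convert this using 2 with ω
  rcases le_total (X ω) (Y ω) with h | h
  · rw [max_eq_right h, abs_of_nonneg (by linarith)]; ring
  · rw [max_eq_left h, abs_of_nonpos (by linarith)]; ring

theorem sum_mem {ι : Type*} (s : Finset ι) {X : ι → Ω → ℝ} (h : ∀ i ∈ s, X i ∈ S.H) :
    (fun ω => ∑ i ∈ s, X i ω) ∈ S.H := by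
  classical
  induction s using Finset.induction_on with
  | empty => simpa using const_mem 0
  | insert j s hj ih =>
    simp only [Finset.sum_insert hj]
    exact add_mem (h j (by simp)) (ih fun i hi => h i (by simp [hi]))

theorem prod_mem {ι : Type*} (s : Finset ι) {X : ι → Ω → ℝ} (h : ∀ i ∈ s, X i ∈ S.H) :
    (fun ω => ∏ i ∈ s, X i ω) ∈ S.H := by
  classical
  induction s using Finset.induction_on with
  | empty => simpa using const_mem 1
  | insert j s hj ih =>
    simp only [Finset.prod_insert hj]
    exact mul_mem (h j (by simp)) (ih fun i hi => h i (by simp [hi]))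

theorem sup'_mem {ι : Type*} (s : Finset ι) (hs : s.Nonempty) {X : ι → Ω → ℝ}
    (h : ∀ i ∈ s, X i ∈ S.H) : (fun ω => s.sup' hs (fun i => X i ω)) ∈ S.H := by
  classical
  induction hs using Finset.Nonempty.cons_induction with
  | singleton j => simpa using h j (by simp)
  | cons j s hj hs ih =>
    simp only [Finset.sup'_cons hs]
    exact max_mem (h j (by simp)) (ih fun i hi => h i (by simp [hi]))

/-- For `p ≥ 1` the power `|x|^p` is locally Lipschitz with polynomial growth. -/
theorem abs_rpow_mem {X : Ω → ℝ} (hX : X ∈ S.H) {p : ℝ} (hp : 1 ≤ p) :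
    (fun ω => |X ω| ^ p) ∈ S.H := by
  obtain ⟨m, hm⟩ := exists_nat_ge (p - 1)
  have hp0 : 0 < p := by linarith
  -- the mean value bound `y^p - x^p ≤ p y^(p-1) (y - x)` comes from Bernoulli's inequality
  have key : ∀ x y : ℝ, 0 ≤ x → x ≤ y → y ^ p - x ^ p ≤ p * (1 + y ^ m) * (y - x) := by
    intro x y hx hxy
    rcases (hx.trans hxy).eq_or_lt with h0 | hy
    · have : x = 0 := by linarith
      simp [← h0, this]
    have h1 := one_add_mul_self_le_rpow_one_add (s := x / y - 1)
      (by have := div_nonneg hx hy.le; linarith) hp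
    rw [add_sub_cancel, Real.div_rpow hx hy.le, le_div_iff₀ (by positivity)] at h1
    have h2 : y ^ p = y ^ (p - 1) * y := by
      rw [← Real.rpow_add_one hy.ne']; simp
    have h3 : y ^ (p - 1) ≤ 1 + y ^ m := by
      rcases le_total y 1 with h | h
      · have := Real.rpow_le_one hy.le h (by linarith : 0 ≤ p - 1)
        have := pow_nonneg hy.le m
        linarith
      · have := Real.rpow_le_rpow_of_exponent_le h hm
        rw [Real.rpow_natCast] at this
        linarith
    have h4 : y ^ p - x ^ p ≤ p * y ^ (p - 1) * (y - x) := by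
      have : (1 + p * (x / y - 1)) * y ^ p = y ^ p - p * y ^ (p - 1) * (y - x) := by
        rw [h2]; field_simp; ring
      linarith
    refine h4.trans ?_
    have : 0 ≤ y - x := by linarith
    gcongr
  refine comp_mem_one hX (φ := fun x => |x| ^ p) hp0 m fun x y => ?_
  wlog hxy : |x| ≤ |y| generalizing x y
  · rw [abs_sub_comm, abs_sub_comm x y, add_right_comm]
    exact this y x (le_of_not_ge hxy)
  have h1 := key |x| |y| (abs_nonneg _) hxy
  have h2 : |x| ^ p ≤ |y| ^ p := Real.rpow_le_rpow (abs_nonneg _) hxy hp0.le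
  rw [abs_sub_comm, abs_of_nonneg (by linarith)]
  refine h1.trans ?_
  have h3 : |y| - |x| ≤ |x - y| := by
    rw [abs_sub_comm]; exact abs_sub_abs_le_abs_sub y x
  have h4 : 0 ≤ |x| ^ m := by positivity
  calc p * (1 + |y| ^ m) * (|y| - |x|) ≤ p * (1 + |y| ^ m) * |x - y| := by gcongr
    _ ≤ _ := by gcongr; linarith

theorem ind_mem {A : Set Ω} (hA : MeasurableSet A) : ind A ∈ S.H := S.indicator_mem A hA

variable (S) in
/-- The sublinear expectation as an element of `[0, ∞]`. It carries the full information on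
nonnegative random variables, to which it is applied. -/
def nnE (Z : Ω → ℝ) : ℝ≥0∞ := (S.E Z).toENNReal

theorem E_nonneg {X : Ω → ℝ} (hX : X ∈ S.H) (h : ∀ ω, 0 ≤ X ω) : 0 ≤ S.E X := by
  have := S.mono X hX _ (const_mem 0) h
  rwa [S.const] at this

theorem coe_nnE {X : Ω → ℝ} (hX : X ∈ S.H) (h : ∀ ω, 0 ≤ X ω) : (S.nnE X : EReal) = S.E X :=
  EReal.coe_toENNReal (E_nonneg hX h)

theorem nnE_mono {X Y : Ω → ℝ} (hX : X ∈ S.H) (hY : Y ∈ S.H) (h : ∀ ω, X ω ≤ Y ω) :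
    S.nnE X ≤ S.nnE Y := EReal.toENNReal_le_toENNReal (S.mono Y hY X hX h)

theorem nnE_const (c : ℝ) : S.nnE (fun _ => c) = ENNReal.ofReal c := by
  rw [nnE, S.const, EReal.toENNReal_of_ne_top (EReal.coe_ne_top c), EReal.toReal_coe]

theorem nnE_const_mul {X : Ω → ℝ} {c : ℝ} (hc : 0 ≤ c) (hX : X ∈ S.H) :
    S.nnE (fun ω => c * X ω) = ENNReal.ofReal c * S.nnE X := by
  rw [nnE, S.pos_homog c hc X hX, EReal.toENNReal_mul (by exact_mod_cast hc), nnE,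
    EReal.toENNReal_of_ne_top (EReal.coe_ne_top c), EReal.toReal_coe]

theorem nnE_add_le {X Y : Ω → ℝ} (hX : X ∈ S.H) (hY : Y ∈ S.H) (hX0 : ∀ ω, 0 ≤ X ω)
    (hY0 : ∀ ω, 0 ≤ Y ω) : S.nnE (fun ω => X ω + Y ω) ≤ S.nnE X + S.nnE Y := by
  have hx := E_nonneg hX hX0
  have hy := E_nonneg hY hY0
  rw [nnE, nnE, nnE, ← EReal.toENNReal_add hx hy]
  refine EReal.toENNReal_le_toENNReal (S.subadd X hX Y hY ?_ ?_)
  · rintro ⟨-, h⟩; simp [h] at hy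
  · rintro ⟨h, -⟩; simp [h] at hx

theorem nnE_sum_le {ι : Type*} (s : Finset ι) {X : ι → Ω → ℝ} (h : ∀ i ∈ s, X i ∈ S.H)
    (h0 : ∀ i ∈ s, ∀ ω, 0 ≤ X i ω) :
    S.nnE (fun ω => ∑ i ∈ s, X i ω) ≤ ∑ i ∈ s, S.nnE (X i) := by
  classical
  induction s using Finset.induction_on with
  | empty => simp [nnE_const]
  | insert j s hj ih =>
    simp only [Finset.sum_insert hj]
    refine (nnE_add_le (h j (by simp)) (sum_mem s fun i hi => h i (by simp [hi])) (h0 j (by simp))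
      fun ω => Finset.sum_nonneg fun i hi => h0 i (by simp [hi]) ω).trans ?_
    gcongr
    exact ih (fun i hi => h i (by simp [hi])) (fun i hi => h0 i (by simp [hi]))

/-- Constants are split off additively. -/
theorem nnE_const_add {X : Ω → ℝ} {c : ℝ} (hc : 0 ≤ c) (hX : X ∈ S.H) (hX0 : ∀ ω, 0 ≤ X ω) :
    S.nnE (fun ω => c + X ω) = ENNReal.ofReal c + S.nnE X := by
  have hcX : (fun ω => c + X ω) ∈ S.H := add_mem (const_mem c) hX
  refine le_antisymm ?_ ?_
  · rw [← nnE_const (S := S)]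
    exact nnE_add_le (const_mem c) hX (fun _ => hc) hX0
  · have h1 := S.subadd _ hcX _ (const_mem (-c)) (by simp [S.const]) (by simp [S.const])
    simp only [add_neg_cancel_comm] at h1
    rw [S.const, ← coe_nnE hX hX0, ← coe_nnE hcX fun ω => add_nonneg hc (hX0 ω)] at h1
    rcases eq_or_ne (S.nnE fun ω => c + X ω) ⊤ with h | h
    · rw [h]; exact le_top
    have h' : S.nnE X ≠ ⊤ := by
      intro h''
      lift S.nnE (fun ω => c + X ω) to NNReal using h with b
      rw [h''] at h1
      have h2 : ((b : ℝ≥0∞) : EReal) + ((-c : ℝ) : EReal) = ((b + -c : ℝ) : EReal) := rfl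
      rw [h2, EReal.coe_ennreal_top, top_le_iff] at h1
      exact EReal.coe_ne_top _ h1
    lift S.nnE (fun ω => c + X ω) to NNReal using h with b
    lift S.nnE X to NNReal using h' with d
    have h2 : ((b : ℝ≥0∞) : EReal) + ((-c : ℝ) : EReal) = ((b + -c : ℝ) : EReal) := rfl
    have h3 : ((d : ℝ≥0∞) : EReal) = ((d : ℝ) : EReal) := rfl
    rw [h2, h3, EReal.coe_le_coe_iff] at h1
    rw [ENNReal.ofReal, ← ENNReal.coe_add, ENNReal.coe_le_coe, ← NNReal.coe_le_coe, NNReal.coe_add,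
      Real.coe_toNNReal c hc]
    linarith

/-- A random variable of mean zero may be removed from an upper bound. -/
theorem nnE_le_of_le_one_add {X Z R : Ω → ℝ} {b : ℝ} (hb : 0 ≤ b) (hX : X ∈ S.H) (hZ : Z ∈ S.H)
    (hR : R ∈ S.H) (hR0 : ∀ ω, 0 ≤ R ω) (hE : S.E X = 0)
    (h : ∀ ω, Z ω ≤ 1 + b * X ω + R ω) : S.nnE Z ≤ 1 + S.nnE R := by
  have hbX := const_mul_mem b hX
  have hbE : S.E (fun ω => b * X ω) = 0 := by rw [S.pos_homog b hb X hX, hE, mul_zero]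
  have h1 : S.E (fun ω => 1 + b * X ω) ≤ 1 := by
    have h2 := S.subadd _ (const_mem 1) _ hbX (by simp [hbE]) (by simp [hbE])
    rwa [S.const, hbE, add_zero] at h2
  have h1X := add_mem (const_mem 1) hbX
  have hR1 := E_nonneg hR hR0
  rcases eq_or_ne (S.E R) ⊤ with hT | hT
  · simp [nnE, hT]
  have h3 : S.E Z ≤ 1 + S.E R := by
    refine (S.mono _ (add_mem h1X hR) Z hZ h).trans ((S.subadd _ h1X R hR ?_ ?_).trans ?_)
    · rintro ⟨-, h⟩; simp [h] at hR1
    · rintro ⟨-, h⟩; exact hT h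
    · gcongr
  have := EReal.toENNReal_le_toENNReal h3
  rw [EReal.toENNReal_add zero_le_one hR1] at this
  have h1' : (1 : EReal).toENNReal = 1 := by
    rw [← EReal.coe_one, EReal.real_coe_toENNReal, ENNReal.ofReal_one]
  rwa [h1'] at this

end SublinearExpectationSpace

namespace SublinearExpectationSpace

variable {Ω : Type*} [MeasurableSpace Ω] {S : SublinearExpectationSpace Ω}

/-! ### Capacity and Choquet integral -/

theorem capacity_eq {A : Set Ω} (hA : MeasurableSet A) : S.capacity A = S.E (ind A) := by
  refine le_antisymm (sInf_le ⟨ind A, ind_mem hA, fun _ => le_rfl, rfl⟩) (le_sInf ?_)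
  rintro v ⟨ξ, hξ, h, rfl⟩
  exact S.mono ξ hξ _ (ind_mem hA) h

theorem toENNReal_capacity {A : Set Ω} (hA : MeasurableSet A) :
    (S.capacity A).toENNReal = S.nnE (ind A) := by
  rw [capacity_eq hA, nnE]

theorem nnE_ind_mono {A B : Set Ω} (hA : MeasurableSet A) (hB : MeasurableSet B) (h : A ⊆ B) :
    S.nnE (ind A) ≤ S.nnE (ind B) := nnE_mono (ind_mem hA) (ind_mem hB) (ind_mono h)

theorem nnE_ind_le_one {A : Set Ω} (hA : MeasurableSet A) : S.nnE (ind A) ≤ 1 := by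
  have := nnE_mono (ind_mem hA) (const_mem (S := S) 1) (ind_le_one A)
  rwa [nnE_const, ENNReal.ofReal_one] at this

theorem nnE_ind_ne_top {A : Set Ω} (hA : MeasurableSet A) : S.nnE (ind A) ≠ ⊤ :=
  ne_top_of_le_ne_top ENNReal.one_ne_top (nnE_ind_le_one hA)

theorem nnE_ind_union_le {A B : Set Ω} (hA : MeasurableSet A) (hB : MeasurableSet B) :
    S.nnE (ind (A ∪ B)) ≤ S.nnE (ind A) + S.nnE (ind B) := by
  refine (nnE_mono (ind_mem (hA.union hB)) (add_mem (ind_mem hA) (ind_mem hB)) fun ω => ?_).trans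
    (nnE_add_le (ind_mem hA) (ind_mem hB) (ind_nonneg A) (ind_nonneg B))
  by_cases h : ω ∈ A
  · rw [ind_of_mem (Set.mem_union_left B h), ind_of_mem h]
    linarith [ind_nonneg B ω]
  by_cases h' : ω ∈ B
  · rw [ind_of_mem (Set.mem_union_right A h'), ind_of_mem h']
    linarith [ind_nonneg A ω]
  · rw [ind_of_notMem (by simp [h, h'])]
    linarith [ind_nonneg B ω, ind_nonneg A ω]

/-- Markov's inequality. -/
theorem ofReal_mul_nnE_ind_le {A : Set Ω} (hA : MeasurableSet A) {Z : Ω → ℝ} (hZ : Z ∈ S.H)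
    {c : ℝ} (hc : 0 ≤ c) (hZ0 : ∀ ω, 0 ≤ Z ω) (h : ∀ ω ∈ A, c ≤ Z ω) :
    ENNReal.ofReal c * S.nnE (ind A) ≤ S.nnE Z := by
  rw [← nnE_const_mul hc (ind_mem hA)]
  refine nnE_mono (const_mul_mem c (ind_mem hA)) hZ fun ω => ?_
  by_cases hω : ω ∈ A
  · rw [ind_of_mem hω, mul_one]; exact h ω hω
  · rw [ind_of_notMem hω, mul_zero]; exact hZ0 ω

theorem choquet_lt_top_iff {Z : Ω → ℝ} (hZ : Measurable Z) (h0 : ∀ ω, 0 ≤ Z ω) :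
    S.choquet Z < ⊤ ↔ ∫⁻ x in Set.Ioi (0 : ℝ), S.nnE (ind {ω | x < Z ω}) < ⊤ := by
  have h1 : ∀ x, (S.capacity {ω | x < Z ω}).toENNReal = S.nnE (ind {ω | x < Z ω}) :=
    fun x => toENNReal_capacity (measurableSet_lt measurable_const hZ)
  have h2 : ∫⁻ x in Set.Iio (0 : ℝ), (1 - S.capacity {ω | x < Z ω}).toENNReal = 0 := by
    rw [setLIntegral_congr_fun measurableSet_Iio (g := 0), Pi.zero_def, lintegral_zero]
    intro x hx
    have h3 : {ω | x < Z ω} = Set.univ :=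
      Set.eq_univ_of_forall fun ω => lt_of_lt_of_le hx (h0 ω)
    have h4 : (ind Set.univ : Ω → ℝ) = fun _ => 1 := funext fun ω => ind_of_mem (Set.mem_univ ω)
    simp only [h3, capacity_eq MeasurableSet.univ, h4, S.const, Pi.zero_apply]
    rw [← EReal.coe_one, ← EReal.coe_sub]
    simp
  simp only [choquet, h1, h2]
  rw [EReal.coe_ennreal_zero, sub_zero, lt_top_iff_ne_top, lt_top_iff_ne_top, Ne, Ne,
    EReal.coe_ennreal_eq_top_iff]

/-- If `0 ≤ Z ≤ c (1 + W)`, then `Z ≤ c + c ∑ₖ 1{W > k}`, and countable sub-additivity bounds the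
expectation of `Z` by the Choquet integral of `W`. -/
theorem nnE_le_choquet (hS : S.CountablySubadditive) {Z W : Ω → ℝ} (hZ : Z ∈ S.H)
    (hZ0 : ∀ ω, 0 ≤ Z ω) (hW : Measurable W) {c : ℝ} (hc : 0 ≤ c)
    (h : ∀ ω, Z ω ≤ c * (1 + W ω)) :
    S.nnE Z ≤ ENNReal.ofReal c * (2 + ∫⁻ x in Set.Ioi (0 : ℝ), S.nnE (ind {ω | x < W ω})) := by
  have hA : ∀ x : ℝ, MeasurableSet {ω | x < W ω} := fun x => measurableSet_lt measurable_const hW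
  let Y : ℕ → Ω → ℝ := fun k => k.casesOn (fun _ => c * 1) fun k ω => c * ind {ω | (k : ℝ) < W ω} ω
  have hYH : ∀ k, Y k ∈ S.H := by
    rintro (_ | k)
    · exact const_mem _
    · exact const_mul_mem c (ind_mem (hA _))
  have hY0 : ∀ k ω, 0 ≤ Y k ω := by
    rintro (_ | k) ω
    · exact mul_nonneg hc zero_le_one
    · exact mul_nonneg hc (ind_nonneg _ _)
  have h1 := hS Z Y hZ hYH hZ0 hY0 fun ω => by
    have h2 := ENNReal.sum_le_tsum (f := fun k => ENNReal.ofReal (Y k ω))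
      (Finset.range (⌈W ω⌉₊ + 1))
    refine le_trans ?_ h2
    rw [← ENNReal.ofReal_sum_of_nonneg fun k _ => hY0 k ω]
    refine ENNReal.ofReal_le_ofReal ((h ω).trans ?_)
    rw [Finset.sum_range_succ', add_comm]
    have h3 : ∑ k ∈ Finset.range ⌈W ω⌉₊, Y (k + 1) ω = ∑ k ∈ Finset.range ⌈W ω⌉₊, c := by
      refine Finset.sum_congr rfl fun k hk => ?_
      have : ind {ω | (k : ℝ) < W ω} ω = 1 :=
        ind_of_mem (Nat.lt_ceil.1 (Finset.mem_range.1 hk))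
      show c * _ = c
      rw [this, mul_one]
    rw [h3]
    show _ ≤ _ + c * 1
    simp only [Finset.sum_const, Finset.card_range, nsmul_eq_mul]
    have := Nat.le_ceil (W ω)
    nlinarith
  refine h1.trans ?_
  have h4 : ∀ k, (S.E (Y (k + 1))).toENNReal = ENNReal.ofReal c * S.nnE (ind {ω | (k : ℝ) < W ω}) :=
    fun k => nnE_const_mul hc (ind_mem (hA _))
  have h5 : (S.E (Y 0)).toENNReal = ENNReal.ofReal c := by
    refine (nnE_const (S := S) (c * 1)).trans ?_
    rw [mul_one]
  rw [tsum_eq_zero_add' ENNReal.summable, h5]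
  simp only [h4]
  rw [ENNReal.tsum_mul_left, mul_add, mul_two, add_assoc]
  gcongr
  rw [tsum_eq_zero_add' ENNReal.summable, mul_add]
  gcongr
  · exact mul_le_of_le_one_right zero_le (nnE_ind_le_one (hA _))
  -- the capacity of `{W > k + 1}` is at most the integral over `(k, k + 1]`
  have hdisj : Pairwise (Function.onFun Disjoint fun k : ℕ => Set.Ioc (k : ℝ) ((k : ℝ) + 1)) := by
    intro i j hij
    simpa [Function.onFun] using
      Set.pairwise_disjoint_Ioc_intCast ℝ (show (i : ℤ) ≠ (j : ℤ) by exact_mod_cast hij)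
  calc ∑' k : ℕ, S.nnE (ind {ω | ((k + 1 : ℕ) : ℝ) < W ω})
      ≤ ∑' k : ℕ, ∫⁻ x in Set.Ioc (k : ℝ) ((k : ℝ) + 1), S.nnE (ind {ω | x < W ω}) := by
        refine ENNReal.tsum_le_tsum fun k => ?_
        have : ∫⁻ x in Set.Ioc (k : ℝ) ((k : ℝ) + 1), S.nnE (ind {ω | ((k + 1 : ℕ) : ℝ) < W ω})
            = S.nnE (ind {ω | ((k + 1 : ℕ) : ℝ) < W ω}) := by
          simp
        rw [← this]
        refine setLIntegral_mono' measurableSet_Ioc fun x hx => ?_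
        refine nnE_ind_mono (hA _) (hA _) fun ω hω => ?_
        have h6 := hx.2
        simp only [Set.mem_ofPred_eq] at hω ⊢
        push_cast at hω
        linarith
    _ = ∫⁻ x in ⋃ k : ℕ, Set.Ioc (k : ℝ) ((k : ℝ) + 1), S.nnE (ind {ω | x < W ω}) :=
        (lintegral_iUnion (fun _ => measurableSet_Ioc) hdisj _).symm
    _ ≤ _ := lintegral_mono_set (Set.iUnion_subset fun k x hx =>
        lt_of_le_of_lt (Nat.cast_nonneg k) hx.1)

/-! ### Independence -/

/-- Iterated expectation for functions of the form `u(X) + g(X) h(Y)` with `u`, `g` bounded and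
nonnegative; these satisfy all side conditions in the definition of independence. -/
theorem Indep.nnE_add_mul {α : Type*} [MeasurableSpace α] {X : Ω → α} {Y : Ω → ℝ}
    (hind : S.Indep X Y) {u g : α → ℝ} {h : ℝ → ℝ} {B : ℝ}
    (hu : Measurable u) (hg : Measurable g) (hh : Measurable h)
    (hu0 : ∀ x, 0 ≤ u x) (hg0 : ∀ x, 0 ≤ g x) (hh0 : ∀ y, 0 ≤ h y)
    (huB : ∀ x, u x ≤ B) (hgB : ∀ x, g x ≤ B)
    (huH : (fun ω => u (X ω)) ∈ S.H) (hgH : (fun ω => g (X ω)) ∈ S.H)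
    (hhH : (fun ω => h (Y ω)) ∈ S.H) (hfin : S.nnE (fun ω => h (Y ω)) ≠ ⊤) :
    S.nnE (fun ω => u (X ω) + g (X ω) * h (Y ω)) =
      S.nnE (fun ω => u (X ω) + g (X ω) * (S.nnE fun ω => h (Y ω)).toReal) := by
  set m : ℝ := (S.nnE fun ω => h (Y ω)).toReal with hm
  have hm0 : 0 ≤ m := ENNReal.toReal_nonneg
  have hψ0 : ∀ x y, 0 ≤ u x + g x * h y := fun x y =>
    add_nonneg (hu0 x) (mul_nonneg (hg0 x) (hh0 y))
  have hψH : ∀ x, (fun ω => u x + g x * h (Y ω)) ∈ S.H := fun x =>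
    add_mem (const_mem _) (const_mul_mem _ hhH)
  have hinner : ∀ x, S.E (fun ω => u x + g x * h (Y ω)) = ((u x + g x * m : ℝ) : EReal) := by
    intro x
    have h1 := nnE_const_add (hu0 x) (const_mul_mem (g x) hhH)
      (fun ω => mul_nonneg (hg0 x) (hh0 _))
    rw [nnE_const_mul (hg0 x) hhH] at h1
    rw [← coe_nnE (hψH x) (fun ω => hψ0 x _), h1, ← ENNReal.ofReal_toReal hfin, ← hm,
      ← ENNReal.ofReal_mul (hg0 x), ← ENNReal.ofReal_add (hu0 x) (mul_nonneg (hg0 x) hm0),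
      EReal.coe_ennreal_ofReal, max_eq_left]
    exact add_nonneg (hu0 x) (mul_nonneg (hg0 x) hm0)
  have habs : ∀ x, S.E (fun ω => |u x + g x * h (Y ω)|) = ((u x + g x * m : ℝ) : EReal) := by
    intro x
    simp only [abs_of_nonneg (hψ0 x _), hinner]
  have hmid : (fun ω => u (X ω) + g (X ω) * m) ∈ S.H :=
    add_mem huH (mul_mem hgH (const_mem m))
  have hbd : S.E (fun ω => u (X ω) + g (X ω) * m) < ⊤ := by
    refine lt_of_le_of_lt (S.mono _ (const_mem (B + B * m)) _ hmid fun ω => ?_)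
      (by rw [S.const]; exact EReal.coe_lt_top _)
    have := huB (X ω)
    have := mul_le_mul_of_nonneg_right (hgB (X ω)) hm0
    linarith
  have key := hind (fun z => u z.1 + g z.1 * h z.2) (by fun_prop)
    (add_mem huH (mul_mem hgH hhH)) hψH
    (fun x => by simp only [habs]; exact EReal.coe_lt_top _)
    (by simpa only [habs, EReal.toReal_coe] using hmid)
    (by simpa only [habs, EReal.toReal_coe] using hbd)
    (by simpa only [hinner, EReal.toReal_coe] using hmid)
  simp only [hinner, EReal.toReal_coe] at key
  rw [nnE, key, nnE]

/-- The sequence with entries `x 0, …, x (n - 1)` at `1, …, n` and zero elsewhere. -/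
def extendSeq (n : ℕ) (x : Fin n → ℝ) (i : ℕ) : ℝ :=
  if h : 1 ≤ i ∧ i ≤ n then x ⟨i - 1, by omega⟩ else 0

theorem measurable_extendSeq (n : ℕ) : Measurable (extendSeq n) := by
  refine measurable_pi_lambda _ fun i => ?_
  unfold extendSeq
  split_ifs
  · exact measurable_pi_apply _
  · exact measurable_const

theorem extendSeq_apply {n i : ℕ} (X : ℕ → ℝ) (hi : i ∈ Finset.Icc 1 n) :
    extendSeq n (fun j : Fin n => X (j + 1)) i = X i := by
  rw [Finset.mem_Icc] at hi
  simp [extendSeq, hi]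

/-- Iterated expectation along an independent sequence: `u` and `g` are functions of the first `n`
entries of the sequence, and `h` is a function of the next one. -/
theorem IndepSeq.nnE_add_mul {X : ℕ → Ω → ℝ} (hind : S.IndepSeq X) {n : ℕ}
    {u g : (ℕ → ℝ) → ℝ} {h : ℝ → ℝ} {B : ℝ}
    (hul : ∀ x y, (∀ i ∈ Finset.Icc 1 n, x i = y i) → u x = u y)
    (hgl : ∀ x y, (∀ i ∈ Finset.Icc 1 n, x i = y i) → g x = g y)
    (hu : Measurable u) (hg : Measurable g) (hh : Measurable h)
    (hu0 : ∀ x, 0 ≤ u x) (hg0 : ∀ x, 0 ≤ g x) (hh0 : ∀ y, 0 ≤ h y)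
    (huB : ∀ x, u x ≤ B) (hgB : ∀ x, g x ≤ B)
    (huH : (fun ω => u (X · ω)) ∈ S.H) (hgH : (fun ω => g (X · ω)) ∈ S.H)
    (hhH : (fun ω => h (X (n + 1) ω)) ∈ S.H) (hfin : S.nnE (fun ω => h (X (n + 1) ω)) ≠ ⊤) :
    S.nnE (fun ω => u (X · ω) + g (X · ω) * h (X (n + 1) ω)) =
      S.nnE (fun ω => u (X · ω) + g (X · ω) * (S.nnE fun ω => h (X (n + 1) ω)).toReal) := by
  rcases Nat.eq_zero_or_pos n with rfl | hn
  · have hu' : ∀ x, u x = u 0 := fun x => hul x 0 (by simp)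
    have hg' : ∀ x, g x = g 0 := fun x => hgl x 0 (by simp)
    simp only [hu' (X · _), hg' (X · _)]
    rw [nnE_const_add (hu0 0) (const_mul_mem _ hhH) (fun ω => mul_nonneg (hg0 0) (hh0 _)),
      nnE_const_mul (hg0 0) hhH, nnE_const, ENNReal.ofReal_add (hu0 0)
      (mul_nonneg (hg0 0) ENNReal.toReal_nonneg), ENNReal.ofReal_mul (hg0 0),
      ENNReal.ofReal_toReal hfin]
  have hu' : ∀ ω, u (extendSeq n fun j : Fin n => X (j + 1) ω) = u (X · ω) := fun ω =>
    hul _ _ fun i hi => extendSeq_apply (X · ω) hi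
  have hg' : ∀ ω, g (extendSeq n fun j : Fin n => X (j + 1) ω) = g (X · ω) := fun ω =>
    hgl _ _ fun i hi => extendSeq_apply (X · ω) hi
  have := (hind n hn).nnE_add_mul (u := u ∘ extendSeq n) (g := g ∘ extendSeq n) (h := h) (B := B)
    (hu.comp (measurable_extendSeq n)) (hg.comp (measurable_extendSeq n)) hh
    (fun _ => hu0 _) (fun _ => hg0 _) hh0 (fun _ => huB _) (fun _ => hgB _)
    (by simpa only [Function.comp_apply, hu'] using huH)
    (by simpa only [Function.comp_apply, hg'] using hgH) hhH hfin
  simpa only [Function.comp_apply, hu', hg'] using this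

/-- Kolmogorov-type maximal inequality for products of independent nonnegative factors whose
expectations are at most `m i`, where `m i ≥ 1`. Stopping the product when it first exceeds `lam`
makes it bounded: the expectation of `lam 1_A + P 1_{Aᶜ}`, where `A` is the event that `lam` has been
exceeded and `P` the current product, grows by at most the factor `m i` in each step. -/
theorem IndepSeq.maximal_prod {X : ℕ → Ω → ℝ} (hind : S.IndepSeq X) {h : ℕ → ℝ → ℝ}
    (hh : ∀ i, Measurable (h i)) (hh0 : ∀ i x, 0 ≤ h i x)
    (hhH : ∀ i, 1 ≤ i → (fun ω => h i (X i ω)) ∈ S.H) {m : ℕ → ℝ} (hm : ∀ i, 1 ≤ m i) (n : ℕ)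
    (hE : ∀ i, 1 ≤ i → i ≤ n → S.nnE (fun ω => h i (X i ω)) ≤ ENNReal.ofReal (m i))
    {lam : ℝ} (hlam : 0 ≤ lam) :
    ENNReal.ofReal lam *
        S.nnE (ind {ω | ∃ j ∈ Finset.Icc 1 n, lam < ∏ i ∈ Finset.Icc 1 j, h i (X i ω)}) ≤
      ENNReal.ofReal (∏ i ∈ Finset.Icc 1 n, m i) := by
  let P : ℕ → (ℕ → ℝ) → ℝ := fun j x => ∏ i ∈ Finset.Icc 1 j, h i (x i)
  let A : ℕ → Set (ℕ → ℝ) := fun n => {x | ∃ j ∈ Finset.Icc 1 n, lam < P j x}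
  have hP : ∀ j, Measurable (P j) := fun j =>
    Finset.measurable_prod _ fun i _ => (hh i).comp (measurable_pi_apply i)
  have hP0 : ∀ j x, 0 ≤ P j x := fun j x => Finset.prod_nonneg fun i _ => hh0 i _
  have hA : ∀ n, MeasurableSet (A n) := fun n => by
    have : A n = ⋃ j ∈ Finset.Icc 1 n, {x | lam < P j x} := by ext; simp [A]
    rw [this]
    exact Finset.measurableSet_biUnion _ fun j _ => measurableSet_lt measurable_const (hP j)
  have hPH : ∀ j, (fun ω => P j (X · ω)) ∈ S.H := fun j =>
    prod_mem _ fun i hi => hhH i (Finset.mem_Icc.1 hi).1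
  have hAΩ : ∀ n, MeasurableSet {ω | (X · ω) ∈ A n} := fun n => by
    have : {ω | (X · ω) ∈ A n} = ⋃ j ∈ Finset.Icc 1 n, {ω | lam < P j (X · ω)} := by ext; simp [A]
    rw [this]
    exact Finset.measurableSet_biUnion _ fun j _ =>
      measurableSet_lt measurable_const (S.measurable_of_mem _ (hPH j))
  let u : ℕ → (ℕ → ℝ) → ℝ := fun n x => lam * ind (A n) x
  let g : ℕ → (ℕ → ℝ) → ℝ := fun n x => P n x * ind (A n)ᶜ x
  have hindA : ∀ n, Measurable (ind (A n)) := fun n => measurable_const.indicator (hA n)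
  have hu : ∀ n, Measurable (u n) := fun n => (hindA n).const_mul _
  have hg : ∀ n, Measurable (g n) := fun n =>
    (hP n).mul (measurable_const.indicator (hA n).compl)
  have hu0 : ∀ n x, 0 ≤ u n x := fun n x => mul_nonneg hlam (ind_nonneg _ _)
  have hg0 : ∀ n x, 0 ≤ g n x := fun n x => mul_nonneg (hP0 n x) (ind_nonneg _ _)
  have huB : ∀ n x, u n x ≤ lam + 1 := fun n x => by
    have := mul_le_mul_of_nonneg_left (ind_le_one (A n) x) hlam
    simp only [u]; linarith
  have hgB : ∀ n x, g n x ≤ lam + 1 := fun n x => by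
    by_cases hx : x ∈ A n
    · simp only [g, ind_of_notMem (Set.notMem_compl_iff.2 hx)]; linarith
    · simp only [g, ind_of_mem (Set.mem_compl hx), mul_one]
      rcases Nat.eq_zero_or_pos n with rfl | hn
      · simp only [P]; simp; linarith
      · have : ¬ lam < P n x := fun h => hx ⟨n, Finset.mem_Icc.2 ⟨hn, le_rfl⟩, h⟩
        linarith
  have huH : ∀ n, (fun ω => u n (X · ω)) ∈ S.H := fun n =>
    const_mul_mem lam (ind_mem (hAΩ n))
  have hgH : ∀ n, (fun ω => g n (X · ω)) ∈ S.H := fun n =>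
    mul_mem (hPH n) (ind_mem (hAΩ n).compl)
  have hPl : ∀ n x y, (∀ i ∈ Finset.Icc 1 n, x i = y i) → P n x = P n y := fun n x y hxy =>
    Finset.prod_congr rfl fun i hi => by rw [hxy i hi]
  have hAl : ∀ n x y, (∀ i ∈ Finset.Icc 1 n, x i = y i) → x ∈ A n → y ∈ A n := by
    rintro n x y hxy ⟨j, hj, hlt⟩
    refine ⟨j, hj, ?_⟩
    rwa [← hPl j x y fun i hi => hxy i (Finset.Icc_subset_Icc_right (Finset.mem_Icc.1 hj).2 hi)]
  have hil : ∀ n x y, (∀ i ∈ Finset.Icc 1 n, x i = y i) → ind (A n) x = ind (A n) y := by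
    intro n x y hxy
    by_cases hx : x ∈ A n
    · rw [ind_of_mem hx, ind_of_mem (hAl n x y hxy hx)]
    · rw [ind_of_notMem hx, ind_of_notMem fun h => hx (hAl n y x (fun i hi => (hxy i hi).symm) h)]
  have hcompl : ∀ n x, ind (A n)ᶜ x = 1 - ind (A n) x := by
    intro n x
    by_cases hx : x ∈ A n
    · rw [ind_of_mem hx, ind_of_notMem (by simpa using hx), sub_self]
    · rw [ind_of_notMem hx, ind_of_mem (Set.mem_compl hx), sub_zero]
  have claim : ∀ k ≤ n, S.nnE (fun ω => u k (X · ω) + g k (X · ω)) ≤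
      ENNReal.ofReal (∏ i ∈ Finset.Icc 1 k, m i) := by
    intro k hk
    induction k with
    | zero =>
      have : ∀ x, u 0 x + g 0 x = 1 := fun x => by simp [u, g, P, A, ind]
      simp only [this, nnE_const]
      simp
    | succ k ih =>
      have hEk := hE (k + 1) (by omega) hk
      have hfin := ne_top_of_le_ne_top ENNReal.ofReal_ne_top hEk
      have hm' : (S.nnE fun ω => h (k + 1) (X (k + 1) ω)).toReal ≤ m (k + 1) :=
        ENNReal.toReal_le_of_le_ofReal (by linarith [hm (k + 1)]) hEk
      have step := hind.nnE_add_mul (n := k) (u := u k) (g := g k) (h := h (k + 1)) (B := lam + 1)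
        (fun x y hxy => by simp only [u, hil k x y hxy])
        (fun x y hxy => by simp only [g, hcompl, hil k x y hxy, hPl k x y hxy])
        (hu k) (hg k) (hh _) (hu0 k) (hg0 k) (hh0 _) (huB k) (hgB k) (huH k) (hgH k)
        (hhH _ (by omega)) hfin
      calc S.nnE (fun ω => u (k + 1) (X · ω) + g (k + 1) (X · ω))
          ≤ S.nnE (fun ω => u k (X · ω) + g k (X · ω) * h (k + 1) (X (k + 1) ω)) := by
            refine nnE_mono (add_mem (huH _) (hgH _))
              (add_mem (huH _) (mul_mem (hgH _) (hhH _ (by omega)))) fun ω => ?_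
            set x : ℕ → ℝ := (X · ω)
            have hPs : P (k + 1) x = P k x * h (k + 1) (x (k + 1)) :=
              Finset.prod_Icc_succ_top (by omega) _
            by_cases hx : x ∈ A k
            · have hx' : x ∈ A (k + 1) := by
                obtain ⟨j, hj, hlt⟩ := hx
                exact ⟨j, Finset.Icc_subset_Icc_right (Nat.le_succ k) hj, hlt⟩
              simp [u, g, hcompl, ind_of_mem hx, ind_of_mem hx']
            · by_cases hx' : x ∈ A (k + 1)
              · have hlt : lam < P (k + 1) x := by
                  obtain ⟨j, hj, hlt⟩ := hx'
                  rcases (Finset.mem_Icc.1 hj).2.lt_or_eq with h1 | h1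
                  · exact absurd ⟨j, Finset.mem_Icc.2 ⟨(Finset.mem_Icc.1 hj).1, by omega⟩, hlt⟩ hx
                  · rwa [h1] at hlt
                rw [hPs] at hlt
                simp only [u, g, hcompl, ind_of_notMem hx, ind_of_mem hx']
                simp only [x] at hlt ⊢
                linarith
              · simp only [u, g, hcompl, ind_of_notMem hx, ind_of_notMem hx', hPs]
                simp only [x]
                linarith
        _ = S.nnE (fun ω => u k (X · ω) + g k (X · ω) *
              (S.nnE fun ω => h (k + 1) (X (k + 1) ω)).toReal) := step
        _ ≤ S.nnE (fun ω => m (k + 1) * (u k (X · ω) + g k (X · ω))) := by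
            refine nnE_mono (add_mem (huH _) (mul_mem (hgH _) (const_mem _)))
              (const_mul_mem _ (add_mem (huH _) (hgH _))) fun ω => ?_
            have h1 := mul_le_mul_of_nonneg_left hm' (hg0 k (X · ω))
            have h2 := mul_le_mul_of_nonneg_right (hm (k + 1)) (hu0 k (X · ω))
            linarith
        _ = ENNReal.ofReal (m (k + 1)) * S.nnE (fun ω => u k (X · ω) + g k (X · ω)) :=
            nnE_const_mul (by linarith [hm (k + 1)]) (add_mem (huH _) (hgH _))
        _ ≤ ENNReal.ofReal (m (k + 1)) * ENNReal.ofReal (∏ i ∈ Finset.Icc 1 k, m i) := by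
            gcongr
            exact ih (by omega)
        _ = _ := by
            rw [← ENNReal.ofReal_mul (by linarith [hm (k + 1)]),
              Finset.prod_Icc_succ_top (by omega), mul_comm]
  refine le_trans ?_ (claim n le_rfl)
  refine ofReal_mul_nnE_ind_le (hAΩ n) (add_mem (huH _) (hgH _)) hlam
    (fun ω => add_nonneg (hu0 _ _) (hg0 _ _)) fun ω hω => ?_
  have h1 : ind (A n) (X · ω) = 1 := ind_of_mem hω
  simp [u, g, hcompl, h1]

/-- For independent random variables the capacity of a union of events `{X i ∈ B i}` is given by
the same product formula as for probabilities. -/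
theorem IndepSeq.nnE_ind_union {X : ℕ → Ω → ℝ} (hind : S.IndepSeq X)
    (hX : ∀ i, 1 ≤ i → X i ∈ S.H) {B : ℕ → Set ℝ} (hB : ∀ i, MeasurableSet (B i)) (n : ℕ) :
    1 - (S.nnE (ind {ω | ∃ i ∈ Finset.Icc 1 n, X i ω ∈ B i})).toReal =
      ∏ i ∈ Finset.Icc 1 n, (1 - (S.nnE (ind {ω | X i ω ∈ B i})).toReal) := by
  let A : ℕ → Set (ℕ → ℝ) := fun n => {x | ∃ i ∈ Finset.Icc 1 n, x i ∈ B i}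
  have hA : ∀ n, MeasurableSet (A n) := fun n => by
    have : A n = ⋃ i ∈ Finset.Icc 1 n, (fun x : ℕ → ℝ => x i) ⁻¹' B i := by ext; simp [A]
    rw [this]
    exact Finset.measurableSet_biUnion _ fun i _ => measurable_pi_apply i (hB i)
  have hBΩ : ∀ i, 1 ≤ i → MeasurableSet {ω | X i ω ∈ B i} := fun i hi =>
    S.measurable_of_mem _ (hX i hi) (hB i)
  have hAΩ : ∀ n, MeasurableSet {ω | (X · ω) ∈ A n} := fun n => by
    have : {ω | (X · ω) ∈ A n} = ⋃ i ∈ Finset.Icc 1 n, {ω | X i ω ∈ B i} := by ext; simp [A]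
    rw [this]
    exact Finset.measurableSet_biUnion _ fun i hi => hBΩ i (Finset.mem_Icc.1 hi).1
  have hAl : ∀ n x y, (∀ i ∈ Finset.Icc 1 n, x i = y i) → x ∈ A n → y ∈ A n := by
    rintro n x y hxy ⟨j, hj, hlt⟩
    exact ⟨j, hj, by rwa [← hxy j hj]⟩
  have hil : ∀ n x y, (∀ i ∈ Finset.Icc 1 n, x i = y i) → ind (A n) x = ind (A n) y := by
    intro n x y hxy
    by_cases hx : x ∈ A n
    · rw [ind_of_mem hx, ind_of_mem (hAl n x y hxy hx)]
    · rw [ind_of_notMem hx, ind_of_notMem fun h => hx (hAl n y x (fun i hi => (hxy i hi).symm) h)]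
  have hindA : ∀ n, Measurable (ind (A n)) := fun n => measurable_const.indicator (hA n)
  have hmem : ∀ n, (fun ω => ind (A n) (X · ω)) ∈ S.H := fun n => ind_mem (hAΩ n)
  show 1 - (S.nnE (fun ω => ind (A n) (X · ω))).toReal = _
  induction n with
  | zero =>
    have : ∀ x, ind (A 0) x = 0 := fun x => ind_of_notMem (by simp [A])
    simp [this, nnE_const]
  | succ n ih =>
    set v : ℝ := (S.nnE (ind {ω | X (n + 1) ω ∈ B (n + 1)})).toReal with hv
    have hv1 : v ≤ 1 :=
      ENNReal.toReal_le_of_le_ofReal zero_le_one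
        (by simpa using nnE_ind_le_one (hBΩ (n + 1) (by omega)))
    have hv0 : 0 ≤ v := ENNReal.toReal_nonneg
    have step := hind.nnE_add_mul (n := n) (u := ind (A n)) (g := fun x => 1 - ind (A n) x)
      (h := ind (B (n + 1))) (B := 1) (hil n) (fun x y hxy => by simp only [hil n x y hxy])
      (hindA n) (measurable_const.sub (hindA n)) (measurable_const.indicator (hB _))
      (ind_nonneg _) (fun x => sub_nonneg.2 (ind_le_one _ x)) (ind_nonneg _) (ind_le_one _)
      (fun x => by linarith [ind_nonneg (A n) x]) (hmem n) (sub_mem (const_mem 1) (hmem n))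
      (ind_mem (hBΩ (n + 1) (by omega))) (nnE_ind_ne_top (hBΩ (n + 1) (by omega)))
    have h1 : (fun ω => ind (A (n + 1)) (X · ω)) = fun ω =>
        ind (A n) (X · ω) + (1 - ind (A n) (X · ω)) * ind (B (n + 1)) (X (n + 1) ω) := by
      funext ω
      by_cases hx : (X · ω) ∈ A n
      · have hx' : (X · ω) ∈ A (n + 1) := by
          obtain ⟨j, hj, hlt⟩ := hx
          exact ⟨j, Finset.Icc_subset_Icc_right (Nat.le_succ n) hj, hlt⟩
        simp [ind_of_mem hx, ind_of_mem hx']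
      · by_cases hy : X (n + 1) ω ∈ B (n + 1)
        · have hx' : (X · ω) ∈ A (n + 1) := ⟨n + 1, by simp, hy⟩
          simp [ind_of_mem hx', ind_of_notMem hx, ind_of_mem hy]
        · have hx' : (X · ω) ∉ A (n + 1) := by
            rintro ⟨j, hj, hlt⟩
            rcases (Finset.mem_Icc.1 hj).2.lt_or_eq with h1 | h1
            · exact hx ⟨j, Finset.mem_Icc.2 ⟨(Finset.mem_Icc.1 hj).1, by omega⟩, hlt⟩
            · subst h1; exact hy hlt
          simp [ind_of_notMem hx', ind_of_notMem hx, ind_of_notMem hy]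
    have h2 : (fun ω => ind (A n) (X · ω) + (1 - ind (A n) (X · ω)) * v) =
        fun ω => v + (1 - v) * ind (A n) (X · ω) := by
      funext ω; ring
    have h3 : (S.nnE fun ω => ind (B (n + 1)) (X (n + 1) ω)).toReal = v := rfl
    rw [h1, step, h3, h2, nnE_const_add hv0 (const_mul_mem _ (hmem n))
      (fun ω => mul_nonneg (by linarith) (ind_nonneg _ _)), nnE_const_mul (by linarith) (hmem n),
      Finset.prod_Icc_succ_top (by omega), ← ih, ← hv]
    have hfin : S.nnE (fun ω => ind (A n) (X · ω)) ≠ ⊤ := nnE_ind_ne_top (hAΩ n)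
    rw [ENNReal.toReal_add ENNReal.ofReal_ne_top (ENNReal.mul_ne_top ENNReal.ofReal_ne_top hfin),
      ENNReal.toReal_mul, ENNReal.toReal_ofReal hv0, ENNReal.toReal_ofReal (by linarith)]
    ring

end SublinearExpectationSpace

/-! ### Layer-cake comparison of weighted tail sums and Choquet integrals -/

theorem ofReal_eq_lintegral_lt (t : ℝ) :
    ENNReal.ofReal t = ∫⁻ u in Set.Ioi (0 : ℝ), if u < t then 1 else 0 := by
  have : (fun u : ℝ => if u < t then (1 : ℝ≥0∞) else 0) = (Set.Iio t).indicator 1 := by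
    funext u; simp [Set.indicator]
  rw [this, lintegral_indicator_one measurableSet_Iio, Measure.restrict_apply measurableSet_Iio,
    Set.Iio_inter_Ioi, Real.volume_Ioo, sub_zero]

theorem lintegral_ofReal_antitone {w : ℝ → ℝ} (hw : Antitone w) :
    ∫⁻ x in Set.Ioi (0 : ℝ), ENNReal.ofReal (w x) =
      ∫⁻ u in Set.Ioi (0 : ℝ), volume ({x | u < w x} ∩ Set.Ioi 0) := by
  have hset : MeasurableSet {z : ℝ × ℝ | z.2 < w z.1} :=
    measurableSet_lt measurable_snd (hw.measurable.comp measurable_fst)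
  simp only [ofReal_eq_lintegral_lt (w _)]
  rw [lintegral_lintegral_swap]
  · refine lintegral_congr fun u => ?_
    have : (fun x : ℝ => if u < w x then (1 : ℝ≥0∞) else 0) = {x | u < w x}.indicator 1 := by
      funext x; simp [Set.indicator]
    have hm : MeasurableSet {x | u < w x} := measurableSet_lt measurable_const hw.measurable
    rw [this, lintegral_indicator_one hm, Measure.restrict_apply hm]
  · exact (Measurable.ite hset measurable_const measurable_const).aemeasurable

theorem tsum_mul_ofReal_eq_lintegral {ι : Type*} [Countable ι] (wt : ι → ℝ≥0∞) (b : ι → ℝ) :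
    ∑' j, wt j * ENNReal.ofReal (b j) =
      ∫⁻ u in Set.Ioi (0 : ℝ), ∑' j, if u < b j then wt j else 0 := by
  have hm : ∀ c : ℝ, Measurable fun u : ℝ => if u < c then (1 : ℝ≥0∞) else 0 := fun c =>
    Measurable.ite measurableSet_Iio measurable_const measurable_const
  have h1 : ∀ j (u : ℝ), (if u < b j then wt j else 0) = wt j * if u < b j then 1 else 0 := by
    intro j u; split_ifs <;> simp
  simp only [h1]
  rw [lintegral_tsum fun j => ((hm (b j)).const_mul _).aemeasurable]
  refine tsum_congr fun j => ?_
  rw [lintegral_const_mul _ (hm _), ← ofReal_eq_lintegral_lt]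

/-- Let `v` be the tail of `ξ ≥ 0` and `w` the tail of `f(ξ)`. If the total weight of the points
`s j ≤ t` is at most `c f(t)`, then the weighted sum of the tails at the points `s j` is at most `c`
times the Choquet integral of `f(ξ)`. -/
theorem tsum_tail_le_lintegral {ι : Type*} [Countable ι] {s : ι → ℝ} (hs : ∀ j, 0 ≤ s j)
    {wt : ι → ℝ≥0∞} {v w f : ℝ → ℝ} {c : ℝ≥0∞} (hw : Antitone w)
    (hvw : ∀ t, 0 ≤ t → w (f t) = v t)
    (hcount : ∀ t, 0 ≤ t → ∑' j, (if s j ≤ t then wt j else 0) ≤ c * ENNReal.ofReal (f t)) :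
    ∑' j, wt j * ENNReal.ofReal (v (s j)) ≤
      c * ∫⁻ x in Set.Ioi (0 : ℝ), ENNReal.ofReal (w x) := by
  have hmeas : Measurable fun u : ℝ => volume ({x | u < w x} ∩ Set.Ioi 0) := by
    have hset : MeasurableSet {z : ℝ × ℝ | z.1 < w z.2} :=
      measurableSet_lt measurable_fst (hw.measurable.comp measurable_snd)
    exact measurable_measure_prodMk_left (ν := volume)
      (hset.inter (measurable_snd measurableSet_Ioi))
  rw [tsum_mul_ofReal_eq_lintegral, lintegral_ofReal_antitone hw, ← lintegral_const_mul _ hmeas]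
  refine lintegral_mono fun u => ?_
  rw [ENNReal.tsum_eq_iSup_sum]
  refine iSup_le fun F => ?_
  rw [← Finset.sum_filter]
  rcases (F.filter fun j => u < v (s j)).eq_empty_or_nonempty with hF | hF
  · rw [hF]; simp
  obtain ⟨k, hk, hmax⟩ := Finset.exists_max_image _ s hF
  calc ∑ j ∈ F.filter (fun j => u < v (s j)), wt j
      ≤ ∑ j ∈ F.filter (fun j => u < v (s j)), (if s j ≤ s k then wt j else 0) :=
        Finset.sum_le_sum fun j hj => by rw [if_pos (hmax j hj)]
    _ ≤ ∑' j, (if s j ≤ s k then wt j else 0) := ENNReal.sum_le_tsum _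
    _ ≤ c * ENNReal.ofReal (f (s k)) := hcount _ (hs k)
    _ ≤ _ := by
        gcongr
        rw [← sub_zero (f (s k)), ← Real.volume_Ioo]
        refine measure_mono fun x hx => ⟨?_, hx.1⟩
        have h1 := hw hx.2.le
        rw [hvw _ (hs k)] at h1
        exact (Finset.mem_filter.1 hk).2.trans_le h1

/-- The converse of `tsum_tail_le_lintegral`: if `f(t)` is bounded by the total weight of the points
`s j ≤ t`, up to constants, then the Choquet integral of `f(ξ)` is bounded by the weighted sum of
the tails at the points `s j`. -/
theorem lintegral_le_tsum_tail {ι : Type*} [Countable ι] {s : ι → ℝ}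
    {wt : ι → ℝ≥0∞} {v w f : ℝ → ℝ} {c : ℝ≥0∞} (hw : Antitone w) (hw1 : ∀ x, w x ≤ 1)
    (hv : Antitone v) (hvw : ∀ t, 0 ≤ t → w (f t) = v t)
    (hsurj : ∀ x, 0 ≤ x → ∃ t, 0 ≤ t ∧ f t = x)
    (hcount : ∀ t, 0 ≤ t →
      ENNReal.ofReal (f t) ≤ c * (1 + ∑' j, (if s j ≤ t then wt j else 0))) :
    ∫⁻ x in Set.Ioi (0 : ℝ), ENNReal.ofReal (w x) ≤
      c * (1 + ∑' j, wt j * ENNReal.ofReal (v (s j))) := by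
  have hone : (1 : ℝ≥0∞) = ∫⁻ u in Set.Ioi (0 : ℝ), if u < 1 then 1 else 0 := by
    rw [← ofReal_eq_lintegral_lt, ENNReal.ofReal_one]
  have hm : Measurable fun u : ℝ => if u < 1 then (1 : ℝ≥0∞) else 0 :=
    Measurable.ite measurableSet_Iio measurable_const measurable_const
  have hm2 : Measurable fun u : ℝ => ∑' j, if u < v (s j) then wt j else 0 :=
    Measurable.tsum fun j =>
      Measurable.ite measurableSet_Iio measurable_const measurable_const
  rw [tsum_mul_ofReal_eq_lintegral, lintegral_ofReal_antitone hw]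
  nth_rw 1 [hone]
  rw [← lintegral_add_left hm,
    ← lintegral_const_mul c (show Measurable fun u : ℝ => (if u < 1 then (1 : ℝ≥0∞) else 0) +
      ∑' j, if u < v (s j) then wt j else 0 from hm.add hm2)]
  refine lintegral_mono fun u => ?_
  rcases le_or_gt 1 u with hu | hu
  · have : {x | u < w x} = ∅ := Set.eq_empty_of_forall_notMem fun x hx =>
      absurd (hw1 x) (not_le.2 (hu.trans_lt hx))
    rw [this, Set.empty_inter, measure_empty]
    exact zero_le
  simp only [if_pos hu]
  set K := c * (1 + ∑' j, if u < v (s j) then wt j else 0) with hK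
  have hx : ∀ x ∈ {x | u < w x} ∩ Set.Ioi 0, ENNReal.ofReal x ≤ K := by
    rintro x ⟨hx1, hx2⟩
    obtain ⟨t, ht, rfl⟩ := hsurj x (le_of_lt hx2)
    refine (hcount t ht).trans ?_
    rw [hK]
    gcongr with j
    by_cases hj : s j ≤ t
    · have h1 : u < v t := by rw [← hvw t ht]; exact hx1
      rw [if_pos hj, if_pos (h1.trans_le (hv hj))]
    · rw [if_neg hj]; exact zero_le
  rcases eq_or_ne K ⊤ with hT | hT
  · rw [hT]; exact le_top
  calc volume ({x | u < w x} ∩ Set.Ioi 0) ≤ volume (Set.Icc 0 K.toReal) := by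
        refine measure_mono fun x hx' => ⟨le_of_lt hx'.2, ?_⟩
        exact (ENNReal.ofReal_le_iff_le_toReal hT).1 (hx x hx')
    _ = K := by rw [Real.volume_Icc, sub_zero, ENNReal.ofReal_toReal hT]

/-! ### The growth function -/

/-- The growth function of the moment condition: with `q = (r - 1) / (1 + β)` the condition reads
`C_V(growth q r |X|) < ∞`. -/
def growth (q r t : ℝ) : ℝ :=
  if q < r then t ^ r else if q = r then t ^ r * Real.log (1 + t) else t ^ q

section Growth

variable {q r : ℝ}

theorem growth_of_lt (h : q < r) (t : ℝ) : growth q r t = t ^ r := if_pos h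

theorem growth_of_eq (h : q = r) (t : ℝ) : growth q r t = t ^ r * Real.log (1 + t) := by
  rw [growth, if_neg h.not_lt, if_pos h]

theorem growth_of_gt (h : r < q) (t : ℝ) : growth q r t = t ^ q := by
  rw [growth, if_neg h.not_gt, if_neg h.ne']

theorem growth_zero (hr : 0 < r) : growth q r 0 = 0 := by
  unfold growth
  split_ifs with h1 h2
  · exact Real.zero_rpow hr.ne'
  · simp
  · exact Real.zero_rpow (by linarith)

theorem growth_strictMonoOn (hr : 0 < r) : StrictMonoOn (growth q r) (Set.Ici 0) := by
  intro x hx y hy hxy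
  have hx : 0 ≤ x := hx
  have h1 := Real.rpow_lt_rpow hx hxy hr
  unfold growth
  split_ifs with h2 h3
  · exact h1
  · have h4 : Real.log (1 + x) < Real.log (1 + y) := Real.log_lt_log (by linarith) (by linarith)
    exact mul_lt_mul'' h1 h4 (by positivity) (Real.log_nonneg (by linarith))
  · exact Real.rpow_lt_rpow hx hxy (by linarith)

theorem growth_nonneg (hr : 0 < r) {t : ℝ} (ht : 0 ≤ t) : 0 ≤ growth q r t := by
  rw [← growth_zero (q := q) hr]
  exact (growth_strictMonoOn hr).monotoneOn (Set.self_mem_Ici) ht ht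

theorem growth_mono (hr : 0 < r) {s t : ℝ} (hs : 0 ≤ s) (hst : s ≤ t) :
    growth q r s ≤ growth q r t :=
  (growth_strictMonoOn hr).monotoneOn hs (hs.trans hst) hst

theorem log_two_mul_rpow_le_growth {t p : ℝ} (ht : 1 ≤ t) (hp : p ≤ r) :
    Real.log 2 * t ^ p ≤ growth q r t := by
  have h0 : t ^ p ≤ t ^ r := Real.rpow_le_rpow_of_exponent_le ht hp
  have h1 : Real.log 2 ≤ 1 := by linarith [Real.log_two_lt_d9]
  have h2 : 0 < Real.log 2 := Real.log_pos (by norm_num)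
  have h3 : 0 < t ^ r := by positivity
  have h4 : Real.log 2 * t ^ p ≤ Real.log 2 * t ^ r := by gcongr
  unfold growth
  split_ifs with h5 h6
  · nlinarith
  · have : Real.log 2 ≤ Real.log (1 + t) := Real.log_le_log (by norm_num) (by linarith)
    nlinarith
  · have : t ^ r ≤ t ^ q := Real.rpow_le_rpow_of_exponent_le ht (by linarith)
    nlinarith

theorem rpow_le_growth (hr : 0 < r) {t p : ℝ} (ht : 0 ≤ t) (hp0 : 0 ≤ p) (hp : p ≤ r) :
    t ^ p ≤ (Real.log 2)⁻¹ * (1 + growth q r t) := by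
  have h2 : 0 < Real.log 2 := Real.log_pos (by norm_num)
  have h1 : Real.log 2 ≤ 1 := by linarith [Real.log_two_lt_d9]
  rw [inv_mul_eq_div, le_div_iff₀ h2, mul_comm]
  have h3 := growth_nonneg (q := q) hr ht
  rcases le_total t 1 with h | h
  · have := Real.rpow_le_one ht h hp0
    have h4 : 0 ≤ t ^ p := by positivity
    nlinarith
  · linarith [log_two_mul_rpow_le_growth (q := q) h hp]

theorem exists_growth_eq (hr : 0 < r) {x : ℝ} (hx : 0 ≤ x) : ∃ t, 0 ≤ t ∧ growth q r t = x := by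
  have h2 : 0 < Real.log 2 := Real.log_pos (by norm_num)
  have hcont : ContinuousOn (growth q r) (Set.Ici 0) := by
    rcases lt_trichotomy q r with h | h | h
    · rw [funext (growth_of_lt h)]
      exact (Real.continuous_rpow_const hr.le).continuousOn
    · rw [funext (growth_of_eq h)]
      refine (Real.continuous_rpow_const hr.le).continuousOn.mul
        (ContinuousOn.log (by fun_prop) fun t ht => ?_)
      have : (0 : ℝ) ≤ t := ht
      linarith
    · rw [funext (growth_of_gt h)]
      exact (Real.continuous_rpow_const (by linarith)).continuousOn
  set b : ℝ := (max 1 (x / Real.log 2)) ^ r⁻¹ with hb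
  have hm : (1 : ℝ) ≤ max 1 (x / Real.log 2) := le_max_left _ _
  have hb1 : 1 ≤ b := Real.one_le_rpow hm (by positivity)
  have hbx : x ≤ growth q r b := by
    refine le_trans ?_ (log_two_mul_rpow_le_growth hb1 le_rfl)
    rw [hb, Real.rpow_inv_rpow (by linarith) hr.ne', ← div_le_iff₀' h2]
    exact le_max_right _ _
  obtain ⟨t, ht, h⟩ := intermediate_value_Icc (by linarith : (0 : ℝ) ≤ b)
    (hcont.mono Set.Icc_subset_Ici_self) (show x ∈ Set.Icc _ _ from
      ⟨by rw [growth_zero hr]; exact hx, hbx⟩)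
  exact ⟨t, ht.1, h⟩

theorem growth_div_le {k t : ℝ} (hk : 1 ≤ k) (ht : 0 ≤ t) :
    growth q r (t / k) ≤ k ^ (-r) * growth q r t := by
  have hk0 : 0 < k := by linarith
  have h1 : (t / k) ^ r = k ^ (-r) * t ^ r := by
    rw [Real.div_rpow ht hk0.le, Real.rpow_neg hk0.le]; ring
  unfold growth
  split_ifs with h2 h3
  · exact h1.le
  · rw [h1, mul_assoc]
    have h4 : t / k ≤ t := div_le_self ht hk
    have h5 : 0 ≤ t / k := by positivity
    have : Real.log (1 + t / k) ≤ Real.log (1 + t) :=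
      Real.log_le_log (by linarith) (by linarith)
    gcongr
  · rw [Real.div_rpow ht hk0.le, div_eq_mul_inv, ← Real.rpow_neg hk0.le, mul_comm]
    gcongr
    linarith

theorem growth_mul_le {K : ℝ} (hK : 1 ≤ K) :
    ∃ D : ℝ, 0 < D ∧ ∀ t, 0 ≤ t → growth q r (K * t) ≤ D * growth q r t := by
  have hK0 : 0 < K := by linarith
  rcases lt_trichotomy q r with h | h | h
  · refine ⟨K ^ r, by positivity, fun t ht => ?_⟩
    rw [growth_of_lt h, growth_of_lt h, Real.mul_rpow hK0.le ht]
  · refine ⟨K ^ r * K, by positivity, fun t ht => ?_⟩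
    rw [growth_of_eq h, growth_of_eq h, Real.mul_rpow hK0.le ht]
    have h1 : Real.log (1 + K * t) ≤ K * Real.log (1 + t) := by
      rw [← Real.log_rpow (by linarith)]
      exact Real.log_le_log (by positivity) (one_add_mul_self_le_rpow_one_add (by linarith) hK)
    calc K ^ r * t ^ r * Real.log (1 + K * t) ≤ K ^ r * t ^ r * (K * Real.log (1 + t)) := by gcongr
      _ = _ := by ring
  · refine ⟨K ^ q, by positivity, fun t ht => ?_⟩
    rw [growth_of_gt h, growth_of_gt h, Real.mul_rpow hK0.le ht]

end Growth

/-! ### Power sums -/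

theorem sum_Icc_rpow_le {a : ℝ} (ha : -1 < a) :
    ∃ C : ℝ, 0 < C ∧ ∀ x : ℝ, 0 ≤ x → ∑ n ∈ Finset.Icc 1 ⌊x⌋₊, (n : ℝ) ^ a ≤ C * x ^ (a + 1) := by
  -- the increments of `n ^ (a + 1)` dominate `n ^ a`, by monotonicity or by Bernoulli's inequality
  have hinc : ∃ C : ℝ, 0 < C ∧ ∀ n : ℕ,
      ((n + 1 : ℕ) : ℝ) ^ a ≤ C * (((n + 1 : ℕ) : ℝ) ^ (a + 1) - (n : ℝ) ^ (a + 1)) := by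
    rcases le_total 0 a with h | h
    · refine ⟨1, one_pos, fun n => ?_⟩
      have hn : (0 : ℝ) < ((n + 1 : ℕ) : ℝ) := by positivity
      have h1 : (n : ℝ) ^ (a + 1) ≤ ((n + 1 : ℕ) : ℝ) ^ a * n := by
        rw [Real.rpow_add_one' (Nat.cast_nonneg n) (by linarith)]
        gcongr
        simp
      rw [Real.rpow_add_one hn.ne', one_mul]
      push_cast at h1 ⊢
      linarith
    · refine ⟨(a + 1)⁻¹, by rw [inv_pos]; linarith, fun n => ?_⟩
      have hn : (0 : ℝ) < ((n + 1 : ℕ) : ℝ) := by positivity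
      rw [inv_mul_eq_div, le_div_iff₀ (by linarith)]
      have h1 := rpow_one_add_le_one_add_mul_self (s := -(((n + 1 : ℕ) : ℝ))⁻¹)
        (by rw [neg_le_neg_iff]; exact inv_le_one_of_one_le₀ (by simp)) (p := a + 1)
        (by linarith) (by linarith)
      have h2 : 1 + -(((n + 1 : ℕ) : ℝ))⁻¹ = n / ((n + 1 : ℕ) : ℝ) := by
        field_simp; push_cast; ring
      rw [h2, Real.div_rpow (Nat.cast_nonneg n) hn.le, div_le_iff₀ (by positivity),
        Real.rpow_add_one hn.ne'] at h1
      rw [Real.rpow_add_one hn.ne']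
      have h3 : (1 + (a + 1) * -(((n + 1 : ℕ) : ℝ))⁻¹) * (((n + 1 : ℕ) : ℝ) ^ a * ((n + 1 : ℕ) : ℝ))
          = ((n + 1 : ℕ) : ℝ) ^ a * ((n + 1 : ℕ) : ℝ) - ((n + 1 : ℕ) : ℝ) ^ a * (a + 1) := by
        field_simp
        ring
      linarith
  obtain ⟨C, hC, hinc⟩ := hinc
  have hnat : ∀ N : ℕ, ∑ n ∈ Finset.Icc 1 N, (n : ℝ) ^ a ≤ C * (N : ℝ) ^ (a + 1) := by
    intro N
    induction N with
    | zero => simp [Real.zero_rpow (by linarith : a + 1 ≠ 0)]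
    | succ N ih =>
      rw [Finset.sum_Icc_succ_top (by omega)]
      linarith [hinc N]
  refine ⟨C, hC, fun x hx => (hnat _).trans ?_⟩
  have := Nat.floor_le hx
  gcongr
  linarith

theorem le_sum_Ioc_rpow (a : ℝ) :
    ∃ c : ℝ, 0 < c ∧ ∀ x : ℝ, 4 ≤ x →
      c * x ^ (a + 1) ≤ ∑ n ∈ Finset.Ioc ⌊x / 2⌋₊ ⌊x⌋₊, (n : ℝ) ^ a := by
  refine ⟨min 1 ((2 : ℝ)⁻¹ ^ a) / 4, by positivity, fun x hx => ?_⟩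
  set d : ℝ := min 1 ((2 : ℝ)⁻¹ ^ a) with hd
  have hd0 : 0 < d := by positivity
  have hx0 : 0 < x := by linarith
  have hterm : ∀ n ∈ Finset.Ioc ⌊x / 2⌋₊ ⌊x⌋₊, d * x ^ a ≤ (n : ℝ) ^ a := by
    intro n hn
    rw [Finset.mem_Ioc] at hn
    have h1 : x / 2 < n := (Nat.floor_lt (by positivity)).1 hn.1
    have h2 : (n : ℝ) ≤ x := (Nat.le_floor_iff hx0.le).1 hn.2
    rcases le_total 0 a with h | h
    · calc d * x ^ a ≤ (2 : ℝ)⁻¹ ^ a * x ^ a := by gcongr; exact min_le_right _ _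
        _ = (x / 2) ^ a := by rw [← Real.mul_rpow (by norm_num) hx0.le]; ring_nf
        _ ≤ _ := by gcongr
    · calc d * x ^ a ≤ 1 * x ^ a := by gcongr; exact min_le_left _ _
        _ = x ^ a := one_mul _
        _ ≤ _ := Real.rpow_le_rpow_of_nonpos (by linarith) h2 h
  have hcard : x / 4 ≤ ((Finset.Ioc ⌊x / 2⌋₊ ⌊x⌋₊).card : ℝ) := by
    rw [Nat.card_Ioc, Nat.cast_sub (Nat.floor_le_floor (by linarith))]
    have h1 := Nat.lt_floor_add_one x
    have h2 := Nat.floor_le (by positivity : 0 ≤ x / 2)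
    linarith
  calc d / 4 * x ^ (a + 1) = x / 4 * (d * x ^ a) := by rw [Real.rpow_add_one hx0.ne']; ring
    _ ≤ ((Finset.Ioc ⌊x / 2⌋₊ ⌊x⌋₊).card : ℝ) * (d * x ^ a) := by gcongr
    _ ≤ _ := by rw [← nsmul_eq_mul]; exact Finset.card_nsmul_le_sum _ _ _ hterm

/-! ### Counting pairs below a given scale -/

/-- The order of magnitude `i (n / i)^γ` of `1 / a n i`, where `γ = 1 + β`. -/
def wscale (γ : ℝ) (n i : ℕ) : ℝ := i * ((n : ℝ) / i) ^ γ

/-- The weight `n^(r - 2)` on pairs `(n, i)` with `1 ≤ i ≤ n`, extended by zero. -/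
def pairWeight (r : ℝ) (p : ℕ × ℕ) : ℝ≥0∞ :=
  if 1 ≤ p.2 ∧ p.2 ≤ p.1 then ENNReal.ofReal ((p.1 : ℝ) ^ (r - 2)) else 0

theorem wscale_nonneg (γ : ℝ) (n i : ℕ) : 0 ≤ wscale γ n i := by unfold wscale; positivity

theorem wscale_pos (γ : ℝ) {n i : ℕ} (hi : 1 ≤ i) (hin : i ≤ n) : 0 < wscale γ n i := by
  have h1 : (0 : ℝ) < i := by exact_mod_cast hi
  have h2 : (0 : ℝ) < n := by exact_mod_cast hi.trans hin
  unfold wscale; positivity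

theorem weight_eq_inv_wscale (β : ℝ) {n i : ℕ} (hi : 1 ≤ i) (hin : i ≤ n) :
    ((i : ℝ) / n) ^ β * (1 / n) = (wscale (1 + β) n i)⁻¹ := by
  have h1 : (0 : ℝ) < i := by exact_mod_cast hi
  have h2 : (0 : ℝ) < n := by exact_mod_cast hi.trans hin
  unfold wscale
  rw [← inv_div (i : ℝ) n, Real.inv_rpow (by positivity), mul_inv, inv_inv,
    Real.rpow_add (by positivity), Real.rpow_one]
  field_simp

theorem wscale_le_iff {γ : ℝ} (hγ : 0 < γ) {n i : ℕ} (hi : 1 ≤ i) {t : ℝ} (ht : 0 ≤ t) :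
    wscale γ n i ≤ t ↔ (n : ℝ) ≤ i * (t / i) ^ γ⁻¹ := by
  have h1 : (0 : ℝ) < i := by exact_mod_cast hi
  unfold wscale
  rw [← le_div_iff₀' h1, ← Real.le_rpow_inv_iff_of_pos (by positivity) (by positivity) hγ,
    div_le_iff₀' h1]

theorem le_wscale {γ : ℝ} (hγ : 0 ≤ γ) {n i : ℕ} (hi : 1 ≤ i) (hin : i ≤ n) :
    (i : ℝ) ≤ wscale γ n i := by
  have h1 : (0 : ℝ) < i := by exact_mod_cast hi
  refine le_mul_of_one_le_right h1.le (Real.one_le_rpow ?_ hγ)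
  rw [one_le_div h1]
  exact_mod_cast hin

theorem rpow_min_le_wscale (γ : ℝ) {n i : ℕ} (hi : 1 ≤ i) (hin : i ≤ n) :
    (n : ℝ) ^ min 1 γ ≤ wscale γ n i := by
  have h1 : (1 : ℝ) ≤ i := by exact_mod_cast hi
  have h2 : (i : ℝ) ≤ n := by exact_mod_cast hin
  have h3 : (1 : ℝ) ≤ (n : ℝ) / i := by rwa [one_le_div (by linarith)]
  unfold wscale
  rcases le_total 1 γ with h | h
  · rw [min_eq_left h, Real.rpow_one]
    have := Real.rpow_le_rpow_of_exponent_le h3 h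
    rw [Real.rpow_one] at this
    calc (n : ℝ) = i * ((n : ℝ) / i) := by field_simp
      _ ≤ _ := by gcongr
  · rw [min_eq_right h]
    have h4 : (i : ℝ) ^ γ ≤ i := by
      have := Real.rpow_le_rpow_of_exponent_le h1 h
      rwa [Real.rpow_one] at this
    calc (n : ℝ) ^ γ = (i : ℝ) ^ γ * ((n : ℝ) / i) ^ γ := by
          rw [← Real.mul_rpow (by linarith) (by linarith)]
          congr 1; field_simp
      _ ≤ _ := by gcongr

/-- `t^q ∑_{i ≤ t} i^(r - 1 - q)` has at most the order of `growth q r t`. The three cases of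
`growth` are the exponents above, at, and below `-1`. -/
theorem exists_rpow_mul_sum_le_growth (q : ℝ) {r : ℝ} (hr : 0 < r) :
    ∃ C : ℝ, 0 < C ∧ ∀ t : ℝ, 0 ≤ t →
      t ^ q * ∑ i ∈ Finset.Icc 1 ⌊t⌋₊, (i : ℝ) ^ (r - 1 - q) ≤ C * growth q r t := by
  suffices h : ∃ C : ℝ, 0 < C ∧ ∀ t : ℝ, 1 ≤ t →
      t ^ q * ∑ i ∈ Finset.Icc 1 ⌊t⌋₊, (i : ℝ) ^ (r - 1 - q) ≤ C * growth q r t by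
    obtain ⟨C, hC, h⟩ := h
    refine ⟨C, hC, fun t ht => ?_⟩
    rcases le_or_gt 1 t with h1 | h1
    · exact h t h1
    · rw [Nat.floor_eq_zero.2 h1]
      simpa using mul_nonneg hC.le (growth_nonneg hr ht)
  rcases lt_trichotomy q r with h | h | h
  · obtain ⟨C, hC, h1⟩ := sum_Icc_rpow_le (a := r - 1 - q) (by linarith)
    refine ⟨C, hC, fun t ht => ?_⟩
    have ht0 : 0 < t := by linarith
    rw [growth_of_lt h]
    calc _ ≤ t ^ q * (C * t ^ (r - 1 - q + 1)) := by gcongr; exact h1 t ht0.le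
      _ = C * (t ^ q * t ^ (r - 1 - q + 1)) := by ring
      _ = C * t ^ r := by rw [← Real.rpow_add ht0]; ring_nf
  · have hl2 : 0 < Real.log 2 := Real.log_pos (by norm_num)
    refine ⟨1 + (Real.log 2)⁻¹, by positivity, fun t ht => ?_⟩
    have ht0 : 0 < t := by linarith
    rw [growth_of_eq h]
    have h1 := harmonic_floor_le_one_add_log t ht
    rw [harmonic_eq_sum_Icc] at h1
    push_cast at h1
    have h2 : ∀ i : ℕ, (i : ℝ) ^ (r - 1 - q) = (i : ℝ)⁻¹ := fun i => by
      rw [h, sub_sub_cancel_left, Real.rpow_neg_one]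
    simp only [h2]
    have h3 : Real.log t ≤ Real.log (1 + t) := Real.log_le_log ht0 (by linarith)
    have h4 : 1 ≤ (Real.log 2)⁻¹ * Real.log (1 + t) := by
      rw [inv_mul_eq_div, one_le_div hl2]
      exact Real.log_le_log (by norm_num) (by linarith)
    calc _ ≤ t ^ q * ((1 + (Real.log 2)⁻¹) * Real.log (1 + t)) := by gcongr; linarith
      _ = _ := by rw [h]; ring
  · have hsum : Summable fun i : ℕ => (i : ℝ) ^ (r - 1 - q) :=
      Real.summable_nat_rpow.2 (by linarith)
    refine ⟨∑' i : ℕ, (i : ℝ) ^ (r - 1 - q) + 1, by positivity, fun t ht => ?_⟩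
    rw [growth_of_gt h, mul_comm]
    gcongr
    have := hsum.sum_le_tsum (Finset.Icc 1 ⌊t⌋₊) fun i _ => by positivity
    linarith

theorem exists_growth_le_rpow_mul_sum (q r : ℝ) {K : ℝ} (hK : 1 ≤ K) :
    ∃ c : ℝ, 0 < c ∧ ∀ t : ℝ, 4 * K ≤ t →
      c * growth q r t ≤ t ^ q * ∑ i ∈ Finset.Icc 1 ⌊t / K⌋₊, (i : ℝ) ^ (r - 1 - q) := by
  have hK0 : 0 < K := by linarith
  rcases lt_trichotomy q r with h | h | h
  · obtain ⟨c, hc, h1⟩ := le_sum_Ioc_rpow (r - 1 - q)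
    refine ⟨c * K⁻¹ ^ (r - q), by positivity, fun t ht => ?_⟩
    have ht0 : 0 < t := by linarith
    rw [growth_of_lt h]
    have h2 := h1 (t / K) (by rwa [le_div_iff₀ hK0])
    have h3 : ∑ n ∈ Finset.Ioc ⌊t / K / 2⌋₊ ⌊t / K⌋₊, (n : ℝ) ^ (r - 1 - q) ≤
        ∑ i ∈ Finset.Icc 1 ⌊t / K⌋₊, (i : ℝ) ^ (r - 1 - q) := by
      refine Finset.sum_le_sum_of_subset_of_nonneg (fun i hi => ?_) fun i _ _ => by positivity
      rw [Finset.mem_Ioc] at hi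
      rw [Finset.mem_Icc]
      exact ⟨by omega, hi.2⟩
    calc c * K⁻¹ ^ (r - q) * t ^ r = t ^ q * (c * (t / K) ^ (r - 1 - q + 1)) := by
          rw [show r - 1 - q + 1 = r - q by ring, div_eq_mul_inv, Real.mul_rpow ht0.le
            (by positivity), show t ^ r = t ^ q * t ^ (r - q) by rw [← Real.rpow_add ht0]; ring_nf]
          ring
      _ ≤ _ := by gcongr; exact h2.trans h3
  · have hl : 0 ≤ Real.log (2 * K) := Real.log_nonneg (by linarith)
    refine ⟨(1 + Real.log (2 * K))⁻¹, by positivity, fun t ht => ?_⟩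
    have ht0 : 0 < t := by linarith
    rw [growth_of_eq h]
    set N := ⌊t / K⌋₊ with hN
    have h1 := log_add_one_le_harmonic N
    rw [harmonic_eq_sum_Icc] at h1
    push_cast at h1
    have h2 : ∀ i : ℕ, (i : ℝ) ^ (r - 1 - q) = (i : ℝ)⁻¹ := fun i => by
      rw [h, sub_sub_cancel_left, Real.rpow_neg_one]
    simp only [h2]
    have h4N : 4 ≤ N := Nat.le_floor (by rw [le_div_iff₀ hK0]; exact_mod_cast ht)
    have h4N' : (4 : ℝ) ≤ N := by exact_mod_cast h4N
    have h5 : 1 ≤ Real.log (N + 1) := by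
      rw [Real.le_log_iff_exp_le (by positivity)]
      linarith [Real.exp_one_lt_d9]
    have h6 : Real.log (1 + t) ≤ Real.log (2 * K) + Real.log (N + 1) := by
      rw [← Real.log_mul (by positivity) (by positivity)]
      refine Real.log_le_log (by positivity) ?_
      have h7 := Nat.lt_floor_add_one (t / K)
      rw [div_lt_iff₀ hK0, ← hN] at h7
      nlinarith
    have h7 : Real.log (1 + t) ≤ (1 + Real.log (2 * K)) * Real.log (N + 1) := by nlinarith
    rw [inv_mul_eq_div, div_le_iff₀ (by positivity), h]
    calc t ^ r * Real.log (1 + t) ≤ t ^ r * ((1 + Real.log (2 * K)) * Real.log (N + 1)) := by gcongr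
      _ = t ^ r * Real.log (N + 1) * (1 + Real.log (2 * K)) := by ring
      _ ≤ _ := by gcongr
  · refine ⟨1, one_pos, fun t ht => ?_⟩
    have ht0 : 0 < t := by linarith
    rw [growth_of_gt h, one_mul]
    refine le_mul_of_one_le_right (by positivity) ?_
    have h1 : 1 ∈ Finset.Icc 1 ⌊t / K⌋₊ := by
      rw [Finset.mem_Icc]
      exact ⟨le_rfl, Nat.le_floor (by rw [le_div_iff₀ hK0]; push_cast; linarith)⟩
    have := Finset.single_le_sum (f := fun i : ℕ => (i : ℝ) ^ (r - 1 - q))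
      (fun i _ => by positivity) h1
    simpa using this

/-- The largest `n` with `wscale γ n i ≤ t` is about `i (t / i)^(1/γ)`; its power `r - 1` is the
order of the sum of `n^(r - 2)` over these `n`. -/
theorem rpow_threshold {γ r t : ℝ} (ht : 0 < t) {i : ℕ} (hi : 1 ≤ i) :
    ((i : ℝ) * (t / i) ^ γ⁻¹) ^ (r - 1) =
      t ^ ((r - 1) / γ) * (i : ℝ) ^ (r - 1 - (r - 1) / γ) := by
  have h1 : (0 : ℝ) < i := by exact_mod_cast hi
  rw [Real.mul_rpow h1.le (by positivity), ← Real.rpow_mul (by positivity),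
    Real.div_rpow ht.le h1.le, Real.rpow_sub h1 (r - 1), inv_mul_eq_div]
  ring

/-- The total weight of the pairs with `wscale γ n i ≤ t` has at most the order of `growth`. -/
theorem tsum_pairWeight_le {γ r : ℝ} (hγ : 0 < γ) (hr : 1 < r) :
    ∃ C : ℝ, 0 < C ∧ ∀ t : ℝ, 0 ≤ t →
      ∑' p : ℕ × ℕ, (if wscale γ p.1 p.2 ≤ t then pairWeight r p else 0) ≤
        ENNReal.ofReal C * ENNReal.ofReal (growth ((r - 1) / γ) r t) := by
  obtain ⟨C₁, hC₁, h₁⟩ := sum_Icc_rpow_le (a := r - 2) (by linarith)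
  obtain ⟨C₂, hC₂, h₂⟩ := exists_rpow_mul_sum_le_growth ((r - 1) / γ) (r := r) (by linarith)
  refine ⟨C₁ * C₂, by positivity, fun t ht => ?_⟩
  rw [ENNReal.tsum_prod', ENNReal.tsum_comm]
  have hinner : ∀ i : ℕ, ∑' n : ℕ, (if wscale γ n i ≤ t then pairWeight r (n, i) else 0) ≤
      if i ∈ Finset.Icc 1 ⌊t⌋₊ then
        ENNReal.ofReal (C₁ * (t ^ ((r - 1) / γ) * (i : ℝ) ^ (r - 1 - (r - 1) / γ))) else 0 := by
    intro i
    split_ifs with hi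
    · rw [Finset.mem_Icc] at hi
      have hi0 : (0 : ℝ) < i := by exact_mod_cast hi.1
      have ht0 : 0 < t := hi0.trans_le ((Nat.le_floor_iff ht).1 hi.2)
      set L : ℝ := i * (t / i) ^ γ⁻¹ with hL
      have hL0 : 0 ≤ L := by positivity
      calc ∑' n : ℕ, (if wscale γ n i ≤ t then pairWeight r (n, i) else 0)
          ≤ ∑' n : ℕ, (if n ∈ Finset.Icc 1 ⌊L⌋₊ then ENNReal.ofReal ((n : ℝ) ^ (r - 2)) else 0) := by
            refine ENNReal.tsum_le_tsum fun n => ?_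
            by_cases h : wscale γ n i ≤ t ∧ (1 ≤ i ∧ i ≤ n)
            · have h3 : n ∈ Finset.Icc 1 ⌊L⌋₊ := by
                rw [Finset.mem_Icc, Nat.le_floor_iff hL0, ← wscale_le_iff hγ hi.1 ht]
                exact ⟨h.2.1.trans h.2.2, h.1⟩
              rw [if_pos h.1, if_pos h3, pairWeight, if_pos h.2]
            · have : (if wscale γ n i ≤ t then pairWeight r (n, i) else 0) = 0 := by
                unfold pairWeight
                by_cases h4 : wscale γ n i ≤ t
                · rw [if_pos h4, if_neg fun h5 => h ⟨h4, h5⟩]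
                · rw [if_neg h4]
              rw [this]
              exact zero_le
        _ = ∑ n ∈ Finset.Icc 1 ⌊L⌋₊, ENNReal.ofReal ((n : ℝ) ^ (r - 2)) := by
            rw [tsum_eq_sum (s := Finset.Icc 1 ⌊L⌋₊) fun n hn => if_neg hn]
            exact Finset.sum_congr rfl fun n hn => if_pos hn
        _ = ENNReal.ofReal (∑ n ∈ Finset.Icc 1 ⌊L⌋₊, (n : ℝ) ^ (r - 2)) :=
            (ENNReal.ofReal_sum_of_nonneg fun n _ => by positivity).symm
        _ ≤ _ := by
            refine ENNReal.ofReal_le_ofReal ((h₁ L hL0).trans_eq ?_)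
            rw [← rpow_threshold ht0 hi.1, show r - 2 + 1 = r - 1 by ring]
    · refine le_of_eq (ENNReal.tsum_eq_zero.2 fun n => ?_)
      unfold pairWeight
      by_cases h4 : wscale γ n i ≤ t
      · rw [if_pos h4, if_neg]
        intro h5
        refine hi (Finset.mem_Icc.2 ⟨h5.1, Nat.le_floor ?_⟩)
        exact (le_wscale hγ.le h5.1 h5.2).trans h4
      · rw [if_neg h4]
  refine (ENNReal.tsum_le_tsum hinner).trans ?_
  rw [tsum_eq_sum (s := Finset.Icc 1 ⌊t⌋₊) fun n hn => if_neg hn,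
    Finset.sum_congr rfl fun n hn => if_pos hn,
    ← ENNReal.ofReal_sum_of_nonneg fun n _ => by positivity, ← ENNReal.ofReal_mul (by positivity)]
  refine ENNReal.ofReal_le_ofReal ?_
  rw [← Finset.mul_sum, ← Finset.mul_sum, mul_assoc]
  exact mul_le_mul_of_nonneg_left (h₂ t ht) hC₁.le

/-- The total weight of the pairs with `wscale γ n i ≤ t` has at least the order of `growth`. -/
theorem growth_le_tsum_pairWeight {γ r : ℝ} (hγ : 0 < γ) (hr : 1 < r) :
    ∃ C : ℝ, 0 < C ∧ ∀ t : ℝ, 0 ≤ t → ENNReal.ofReal (growth ((r - 1) / γ) r t) ≤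
      ENNReal.ofReal C *
        (1 + ∑' p : ℕ × ℕ, (if wscale γ p.1 p.2 ≤ t then pairWeight r p else 0)) := by
  -- for `i ≤ t / 4^γ` the threshold for `n` is at least `4 i`, so that half of the range is free
  set K : ℝ := 4 ^ γ with hK
  have hK1 : 1 ≤ K := Real.one_le_rpow (by norm_num) hγ.le
  have hK0 : 0 < K := by linarith
  obtain ⟨c₁, hc₁, h₁⟩ := le_sum_Ioc_rpow (r - 2)
  obtain ⟨c₂, hc₂, h₂⟩ := exists_growth_le_rpow_mul_sum ((r - 1) / γ) r hK1
  have hr0 : 0 < r := by linarith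
  set G := growth ((r - 1) / γ) r (4 * K) with hG
  have hG0 : 0 ≤ G := growth_nonneg hr0 (by positivity)
  refine ⟨G + (c₁ * c₂)⁻¹, by positivity, fun t ht => ?_⟩
  rcases le_total t (4 * K) with htK | htK
  · calc ENNReal.ofReal (growth ((r - 1) / γ) r t) ≤ ENNReal.ofReal (G + (c₁ * c₂)⁻¹) := by
          refine ENNReal.ofReal_le_ofReal ((growth_mono hr0 ht htK).trans ?_)
          rw [← hG, le_add_iff_nonneg_right]
          positivity
      _ ≤ _ := le_mul_of_one_le_right zero_le le_self_add
  have ht0 : 0 < t := by linarith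
  have hmain : ENNReal.ofReal (c₁ * c₂ * growth ((r - 1) / γ) r t) ≤
      ∑' p : ℕ × ℕ, (if wscale γ p.1 p.2 ≤ t then pairWeight r p else 0) := by
    rw [ENNReal.tsum_prod', ENNReal.tsum_comm]
    have hinner : ∀ i ∈ Finset.Icc 1 ⌊t / K⌋₊,
        ENNReal.ofReal (c₁ * (t ^ ((r - 1) / γ) * (i : ℝ) ^ (r - 1 - (r - 1) / γ))) ≤
        ∑' n : ℕ, (if wscale γ n i ≤ t then pairWeight r (n, i) else 0) := by
      intro i hi
      rw [Finset.mem_Icc] at hi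
      have hi0 : (1 : ℝ) ≤ i := by exact_mod_cast hi.1
      set L : ℝ := i * (t / i) ^ γ⁻¹ with hL
      have hiL : 4 * (i : ℝ) ≤ L := by
        have h3 : (i : ℝ) ≤ t / K := (Nat.le_floor_iff (by positivity)).1 hi.2
        have h4 : K ≤ t / i := by
          rw [le_div_iff₀ (by positivity)]
          rw [le_div_iff₀ hK0] at h3
          linarith
        have h5 : (4 : ℝ) ≤ (t / i) ^ γ⁻¹ := by
          rw [Real.le_rpow_inv_iff_of_pos (by norm_num) (by positivity) hγ]
          exact h4
        rw [hL, mul_comm]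
        gcongr
      have hL0 : 0 ≤ L := by linarith
      calc _ ≤ ENNReal.ofReal (∑ n ∈ Finset.Ioc ⌊L / 2⌋₊ ⌊L⌋₊, (n : ℝ) ^ (r - 2)) := by
            refine ENNReal.ofReal_le_ofReal (le_trans (le_of_eq ?_) (h₁ L (by linarith)))
            rw [← rpow_threshold ht0 hi.1, show r - 2 + 1 = r - 1 by ring]
        _ = ∑ n ∈ Finset.Ioc ⌊L / 2⌋₊ ⌊L⌋₊, ENNReal.ofReal ((n : ℝ) ^ (r - 2)) :=
            ENNReal.ofReal_sum_of_nonneg fun n _ => by positivity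
        _ = ∑ n ∈ Finset.Ioc ⌊L / 2⌋₊ ⌊L⌋₊,
              (if wscale γ n i ≤ t then pairWeight r (n, i) else 0) := by
            refine Finset.sum_congr rfl fun n hn => ?_
            rw [Finset.mem_Ioc] at hn
            have h6 : L / 2 < n := (Nat.floor_lt (by positivity)).1 hn.1
            have h7 : (n : ℝ) ≤ L := (Nat.le_floor_iff hL0).1 hn.2
            have h8 : (i : ℝ) ≤ n := by linarith
            rw [if_pos ((wscale_le_iff hγ hi.1 ht).2 h7), pairWeight,
              if_pos ⟨hi.1, by exact_mod_cast h8⟩]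
        _ ≤ _ := ENNReal.sum_le_tsum _
    calc _ ≤ ENNReal.ofReal (∑ i ∈ Finset.Icc 1 ⌊t / K⌋₊,
          c₁ * (t ^ ((r - 1) / γ) * (i : ℝ) ^ (r - 1 - (r - 1) / γ))) := by
            refine ENNReal.ofReal_le_ofReal ?_
            rw [← Finset.mul_sum, ← Finset.mul_sum, mul_assoc]
            exact mul_le_mul_of_nonneg_left (h₂ t htK) hc₁.le
      _ = ∑ i ∈ Finset.Icc 1 ⌊t / K⌋₊,
          ENNReal.ofReal (c₁ * (t ^ ((r - 1) / γ) * (i : ℝ) ^ (r - 1 - (r - 1) / γ))) :=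
            ENNReal.ofReal_sum_of_nonneg fun n _ => by positivity
      _ ≤ _ := (Finset.sum_le_sum hinner).trans (ENNReal.sum_le_tsum _)
  have hcc : (c₁ * c₂)⁻¹ * (c₁ * c₂ * growth ((r - 1) / γ) r t) = growth ((r - 1) / γ) r t := by
    field_simp
  rw [← hcc, ENNReal.ofReal_mul (by positivity)]
  refine mul_le_mul' (ENNReal.ofReal_le_ofReal (by linarith)) ?_
  rw [hcc.symm] at hmain
  exact (by simpa only [hcc] using hmain : _ ≤ _).trans le_add_self

/-! ### The moment condition as a double series of tails -/

namespace SublinearExpectationSpace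

variable {Ω : Type*} [MeasurableSpace Ω] {S : SublinearExpectationSpace Ω}

theorem measurable_growth (q r : ℝ) : Measurable (growth q r) := by
  unfold growth
  split_ifs <;> fun_prop

theorem momentCondition_iff {β r : ℝ} (hβ : -1 < β) (hr : 1 < r) {X : Ω → ℝ} (hX : X ∈ S.H) :
    S.MomentCondition β r X ↔ ∫⁻ x in Set.Ioi (0 : ℝ),
      S.nnE (ind {ω | x < growth ((r - 1) / (1 + β)) r |X ω|}) < ⊤ := by
  have hXm := S.measurable_of_mem X hX
  have hr0 : 0 < r := by linarith
  have hβ0 : 0 < 1 + β := by linarith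
  have hlt : (r - 1) / (1 + β) < r ↔ -1 / r < β := by
    rw [div_lt_iff₀ hβ0, div_lt_iff₀ hr0]
    constructor <;> intro h <;> linarith
  have heq : (r - 1) / (1 + β) = r ↔ β = -1 / r := by
    rw [div_eq_iff hβ0.ne', eq_div_iff hr0.ne']
    constructor <;> intro h <;> linarith
  rw [← choquet_lt_top_iff (Z := fun ω => growth ((r - 1) / (1 + β)) r |X ω|)
    ((measurable_growth _ _).comp (_root_.measurable_abs.comp hXm))
    fun ω => growth_nonneg hr0 (abs_nonneg _)]
  unfold MomentCondition
  rcases lt_trichotomy β (-1 / r) with h | h | h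
  · have h1 : r < (r - 1) / (1 + β) := by
      refine lt_of_le_of_ne (not_lt.1 fun h' => ?_) fun h' => h.ne (heq.1 h'.symm)
      exact h.not_gt (hlt.1 h')
    simp only [growth_of_gt h1, h, h.ne, h.not_gt, forall_true_left, false_imp_iff,
      and_true]
  · have h1 := heq.2 h
    simp only [growth_of_eq h1]
    simp [h]
  · have h1 := hlt.2 h
    simp only [growth_of_lt h1, h, h.ne', h.not_gt, forall_true_left,
      false_imp_iff, true_and]

variable (S) in
/-- The tail capacity `V(|X| > t)`. -/
def tail (X : Ω → ℝ) (t : ℝ) : ℝ≥0∞ := S.nnE (ind {ω | t < |X ω|})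

theorem measurableSet_tail {X : Ω → ℝ} (hX : X ∈ S.H) (t : ℝ) :
    MeasurableSet {ω | t < |X ω|} :=
  measurableSet_lt measurable_const (S.measurable_of_mem _ (abs_mem hX))

theorem tail_le_one {X : Ω → ℝ} (hX : X ∈ S.H) (t : ℝ) : S.tail X t ≤ 1 :=
  nnE_ind_le_one (measurableSet_tail hX t)

theorem tail_ne_top {X : Ω → ℝ} (hX : X ∈ S.H) (t : ℝ) : S.tail X t ≠ ⊤ :=
  nnE_ind_ne_top (measurableSet_tail hX t)

theorem tail_anti {X : Ω → ℝ} (hX : X ∈ S.H) {s t : ℝ} (h : s ≤ t) : S.tail X t ≤ S.tail X s :=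
  nnE_ind_mono (measurableSet_tail hX t) (measurableSet_tail hX s) fun _ hω => h.trans_lt hω

theorem IdentDistrib.nnE_ind {X Y : Ω → ℝ} (h : S.IdentDistrib X Y) (hX : X ∈ S.H) (hY : Y ∈ S.H)
    {B : Set ℝ} (hB : MeasurableSet B) :
    S.nnE (ind {ω | X ω ∈ B}) = S.nnE (ind {ω | Y ω ∈ B}) := by
  have hXm : MeasurableSet {ω | X ω ∈ B} := S.measurable_of_mem X hX hB
  have hYm : MeasurableSet {ω | Y ω ∈ B} := S.measurable_of_mem Y hY hB
  have hfin : ∀ {A : Set Ω}, MeasurableSet A → S.E (ind A) ≠ ⊤ ∧ S.E (ind A) ≠ ⊥ := fun hA => by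
    rw [← coe_nnE (ind_mem hA) (ind_nonneg _)]
    exact ⟨by simpa using nnE_ind_ne_top hA, EReal.coe_ennreal_ne_bot _⟩
  exact congrArg EReal.toENNReal (h (ind B) (measurable_const.indicator hB) (ind_mem hXm)
    (ind_mem hYm) (hfin hXm).1 (hfin hXm).2 (hfin hYm).1 (hfin hYm).2)

theorem IdentDistrib.tail_eq {X Y : Ω → ℝ} (h : S.IdentDistrib X Y) (hX : X ∈ S.H) (hY : Y ∈ S.H)
    (t : ℝ) : S.tail X t = S.tail Y t :=
  h.nnE_ind hX hY (B := {x | t < |x|}) (measurableSet_lt measurable_const _root_.measurable_abs)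

section Series

variable {X : Ω → ℝ} {q r : ℝ}

theorem measurableSet_growth (hX : X ∈ S.H) (q r x : ℝ) :
    MeasurableSet {ω | x < growth q r |X ω|} :=
  measurableSet_lt measurable_const
    ((measurable_growth q r).comp (S.measurable_of_mem _ (abs_mem hX)))

theorem antitone_toReal_growth (hX : X ∈ S.H) (q r : ℝ) :
    Antitone fun x => (S.nnE (ind {ω | x < growth q r |X ω|})).toReal := fun _ _ hxy =>
  ENNReal.toReal_mono (nnE_ind_ne_top (measurableSet_growth hX q r _))
    (nnE_ind_mono (measurableSet_growth hX q r _) (measurableSet_growth hX q r _)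
      fun _ hω => lt_of_le_of_lt hxy hω)

theorem nnE_growth_eq_tail (hr : 0 < r) {t : ℝ} (ht : 0 ≤ t) :
    (S.nnE (ind {ω | growth q r t < growth q r |X ω|})).toReal = (S.tail X t).toReal := by
  have : {ω | growth q r t < growth q r |X ω|} = {ω | t < |X ω|} := by
    ext ω
    exact (growth_strictMonoOn hr).lt_iff_lt ht (abs_nonneg (X ω))
  rw [tail, this]

/-- The moment condition makes the tails summable along all multiples of the scales `1 / a n i`. -/
theorem tsum_tail_lt_top (hX : X ∈ S.H) {γ : ℝ} (hγ : 0 < γ) (hr : 1 < r)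
    (hJ : ∫⁻ x in Set.Ioi (0 : ℝ), S.nnE (ind {ω | x < growth ((r - 1) / γ) r |X ω|}) < ⊤)
    {b : ℝ} (hb : 0 < b) :
    ∑' z : ℕ × ℕ × ℕ, pairWeight r z.2 *
      S.tail X (b * (z.1 + 1) * wscale γ z.2.1 z.2.2) < ⊤ := by
  have hr0 : 0 < r := by linarith
  obtain ⟨C, hC, hcount⟩ := tsum_pairWeight_le hγ hr
  obtain ⟨D, hD, hdouble⟩ := growth_mul_le (q := (r - 1) / γ) (r := r) (le_max_left 1 b⁻¹)
  have hsum : Summable fun k : ℕ => ((k : ℝ) + 1) ^ (-r) := by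
    have := (summable_nat_add_iff 1).2 (Real.summable_nat_rpow.2 (by linarith : -r < -1))
    simpa using this
  set Z : ℝ := ∑' k : ℕ, ((k : ℝ) + 1) ^ (-r) with hZ
  have key := tsum_tail_le_lintegral (ι := ℕ × ℕ × ℕ)
    (s := fun z => b * (z.1 + 1) * wscale γ z.2.1 z.2.2)
    (fun z => mul_nonneg (by positivity) (wscale_nonneg _ _ _))
    (wt := fun z => pairWeight r z.2) (v := fun t => (S.tail X t).toReal)
    (w := fun x => (S.nnE (ind {ω | x < growth ((r - 1) / γ) r |X ω|})).toReal)
    (f := growth ((r - 1) / γ) r) (c := ENNReal.ofReal (C * D) * ENNReal.ofReal Z)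
    (antitone_toReal_growth hX _ _) (fun t ht => nnE_growth_eq_tail hr0 ht) (fun t ht => by
      rw [ENNReal.tsum_prod']
      have h1 : ∀ k : ℕ, ∑' p : ℕ × ℕ,
          (if b * ((k : ℝ) + 1) * wscale γ p.1 p.2 ≤ t then pairWeight r p else 0) ≤
          ENNReal.ofReal (C * D * growth ((r - 1) / γ) r t) *
            ENNReal.ofReal (((k : ℝ) + 1) ^ (-r)) := by
        intro k
        have hk : (0 : ℝ) < b * ((k : ℝ) + 1) := by positivity
        have h2 : ∀ p : ℕ × ℕ, (b * ((k : ℝ) + 1) * wscale γ p.1 p.2 ≤ t) =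
            (wscale γ p.1 p.2 ≤ t / (b * ((k : ℝ) + 1))) := fun p => by
          rw [le_div_iff₀' hk]
        simp only [h2]
        refine (hcount _ (by positivity)).trans ?_
        have hg := growth_nonneg (q := (r - 1) / γ) hr0 ht
        rw [← ENNReal.ofReal_mul hC.le, ← ENNReal.ofReal_mul (by positivity)]
        refine ENNReal.ofReal_le_ofReal ?_
        have h3 : growth ((r - 1) / γ) r (t / (b * ((k : ℝ) + 1))) ≤
            ((k : ℝ) + 1) ^ (-r) * growth ((r - 1) / γ) r (t / b) := by
          rw [← div_div]
          exact growth_div_le (by linarith [(Nat.cast_nonneg k : (0 : ℝ) ≤ k)]) (by positivity)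
        have h4 : growth ((r - 1) / γ) r (t / b) ≤ D * growth ((r - 1) / γ) r t := by
          refine le_trans (growth_mono hr0 (by positivity) ?_) (hdouble t ht)
          rw [div_eq_inv_mul]
          gcongr
          exact le_max_right _ _
        calc C * growth ((r - 1) / γ) r (t / (b * ((k : ℝ) + 1)))
            ≤ C * (((k : ℝ) + 1) ^ (-r) * (D * growth ((r - 1) / γ) r t)) := by
              refine mul_le_mul_of_nonneg_left (h3.trans ?_) hC.le
              exact mul_le_mul_of_nonneg_left h4 (by positivity)
          _ = _ := by ring
      refine (ENNReal.tsum_le_tsum h1).trans (le_of_eq ?_)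
      rw [ENNReal.tsum_mul_left, ← ENNReal.ofReal_tsum_of_nonneg (fun k => by positivity) hsum,
        ENNReal.ofReal_mul (by positivity), ← hZ]
      ring)
  have h5 : ∀ A : Set Ω, MeasurableSet A →
      ENNReal.ofReal (S.nnE (ind A)).toReal = S.nnE (ind A) := fun A hA =>
    ENNReal.ofReal_toReal (nnE_ind_ne_top hA)
  simp only [ENNReal.ofReal_toReal (tail_ne_top hX _), h5 _ (measurableSet_growth hX _ _ _)] at key
  exact key.trans_lt (ENNReal.mul_lt_top (ENNReal.mul_lt_top ENNReal.ofReal_lt_top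
    ENNReal.ofReal_lt_top) hJ)

/-- Summability of the tails along a multiple of the scales `1 / a n i` gives back the moment
condition. -/
theorem lintegral_growth_lt_top (hX : X ∈ S.H) {γ : ℝ} (hγ : 0 < γ) (hr : 1 < r) {b : ℝ}
    (hb : 0 < b) (hsum : ∑' p : ℕ × ℕ, pairWeight r p * S.tail X (b * wscale γ p.1 p.2) < ⊤) :
    ∫⁻ x in Set.Ioi (0 : ℝ), S.nnE (ind {ω | x < growth ((r - 1) / γ) r |X ω|}) < ⊤ := by
  have hr0 : 0 < r := by linarith
  obtain ⟨C, hC, hcount⟩ := growth_le_tsum_pairWeight hγ hr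
  obtain ⟨D, hD, hdouble⟩ := growth_mul_le (q := (r - 1) / γ) (r := r) (le_max_left 1 b)
  have key := lintegral_le_tsum_tail (ι := ℕ × ℕ)
    (s := fun p => b * wscale γ p.1 p.2)
    (wt := pairWeight r) (v := fun t => (S.tail X t).toReal)
    (w := fun x => (S.nnE (ind {ω | x < growth ((r - 1) / γ) r |X ω|})).toReal)
    (f := growth ((r - 1) / γ) r) (c := ENNReal.ofReal D * ENNReal.ofReal C)
    (antitone_toReal_growth hX _ _)
    (fun x => ENNReal.toReal_le_of_le_ofReal zero_le_one
      (by simpa using nnE_ind_le_one (measurableSet_growth hX _ _ x)))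
    (fun _ _ h => ENNReal.toReal_mono (tail_ne_top hX _) (tail_anti hX h))
    (fun t ht => nnE_growth_eq_tail hr0 ht) (fun x hx => exists_growth_eq hr0 hx)
    (fun t ht => by
      have h2 : ∀ p : ℕ × ℕ, (b * wscale γ p.1 p.2 ≤ t) = (wscale γ p.1 p.2 ≤ t / b) :=
        fun p => by rw [le_div_iff₀' hb]
      simp only [h2]
      have h3 : growth ((r - 1) / γ) r t ≤ D * growth ((r - 1) / γ) r (t / b) := by
        refine le_trans (growth_mono hr0 ht ?_) (hdouble (t / b) (by positivity))
        calc t = b * (t / b) := by field_simp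
          _ ≤ _ := by gcongr; exact le_max_right _ _
      calc ENNReal.ofReal (growth ((r - 1) / γ) r t)
          ≤ ENNReal.ofReal D * ENNReal.ofReal (growth ((r - 1) / γ) r (t / b)) := by
            rw [← ENNReal.ofReal_mul hD.le]
            exact ENNReal.ofReal_le_ofReal h3
        _ ≤ _ := by
            rw [mul_assoc]
            gcongr
            exact hcount _ (by positivity))
  have h5 : ∀ A : Set Ω, MeasurableSet A →
      ENNReal.ofReal (S.nnE (ind A)).toReal = S.nnE (ind A) := fun A hA =>
    ENNReal.ofReal_toReal (nnE_ind_ne_top hA)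
  simp only [ENNReal.ofReal_toReal (tail_ne_top hX _), h5 _ (measurableSet_growth hX _ _ _)] at key
  exact key.trans_lt (ENNReal.mul_lt_top (ENNReal.mul_lt_top ENNReal.ofReal_lt_top
    ENNReal.ofReal_lt_top) (ENNReal.add_lt_top.2 ⟨ENNReal.one_lt_top, hsum⟩))

end Series

end SublinearExpectationSpace

/-! ### Truncation and the exponential maximal inequality -/

namespace SublinearExpectationSpace

variable {Ω : Type*} [MeasurableSpace Ω] {S : SublinearExpectationSpace Ω}

/-- Truncation at height one. -/
def clampOne (z : ℝ) : ℝ := max (-1) (min 1 z)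

theorem abs_clampOne_le (z : ℝ) : |clampOne z| ≤ 1 :=
  abs_le.2 ⟨le_max_left _ _, max_le (by norm_num) (min_le_left _ _)⟩

theorem clampOne_of_abs_le {z : ℝ} (h : |z| ≤ 1) : clampOne z = z := by
  rw [clampOne, min_eq_right (abs_le.1 h).2, max_eq_right (abs_le.1 h).1]

theorem clampOne_neg (z : ℝ) : clampOne (-z) = -clampOne z := by
  unfold clampOne
  rcases le_total z 1 with h | h <;> rcases le_total (-1) z with h' | h' <;>
    grind

theorem measurable_clampOne : Measurable clampOne := by
  unfold clampOne; fun_prop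

theorem abs_clampOne_sub_le (x y : ℝ) : |clampOne x - clampOne y| ≤ |x - y| := by
  unfold clampOne
  exact (abs_max_sub_max_le_max _ _ _ _).trans (by
    rw [sub_self, abs_zero, max_eq_right (abs_nonneg _)]
    refine (abs_min_sub_min_le_max _ _ _ _).trans ?_
    rw [sub_self, abs_zero, max_eq_right (abs_nonneg _)])

theorem abs_sub_clampOne (z : ℝ) : |z - clampOne z| = max (|z| - 1) 0 := by
  unfold clampOne
  rcases le_total 0 z with h | h <;> rcases le_total |z| 1 with h' | h' <;> grind

theorem exp_mul_clampOne_mem {X : Ω → ℝ} (hX : X ∈ S.H) (D b : ℝ) :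
    (fun ω => Real.exp (D * clampOne (b * X ω))) ∈ S.H := by
  have hb : (fun ω => b * X ω) ∈ S.H := const_mul_mem b hX
  refine comp_mem_of_lipschitz hb (φ := fun z => Real.exp (D * clampOne z))
    (C := Real.exp |D| * |D|) fun x y => ?_
  -- the mean value inequality on `[-|D|, |D|]`, by convexity of the exponential
  have key : ∀ u v : ℝ, |u| ≤ |D| → Real.exp u - Real.exp v ≤ Real.exp |D| * |u - v| := by
    intro u v hu
    have h1 := Real.add_one_le_exp (v - u)
    have h2 : Real.exp v = Real.exp u * Real.exp (v - u) := by rw [← Real.exp_add]; ring_nf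
    have h3 : Real.exp u ≤ Real.exp |D| := Real.exp_le_exp.2 ((le_abs_self u).trans hu)
    have h4 := le_abs_self (u - v)
    calc Real.exp u - Real.exp v = Real.exp u * (1 - Real.exp (v - u)) := by rw [h2]; ring
      _ ≤ Real.exp u * |u - v| := by gcongr; linarith
      _ ≤ _ := by gcongr
  have hbd : ∀ z, |D * clampOne z| ≤ |D| := fun z => by
    rw [abs_mul]
    exact mul_le_of_le_one_right (abs_nonneg D) (abs_clampOne_le z)
  have h5 : |D * clampOne x - D * clampOne y| ≤ |D| * |x - y| := by
    rw [← mul_sub, abs_mul]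
    exact mul_le_mul_of_nonneg_left (abs_clampOne_sub_le x y) (abs_nonneg D)
  have h6 := mul_le_mul_of_nonneg_left h5 (Real.exp_pos |D|).le
  rw [mul_assoc]
  refine le_trans (abs_le.2 ⟨?_, ?_⟩) h6
  · have := key _ (D * clampOne x) (hbd y)
    rw [abs_sub_comm] at this
    linarith
  · exact key _ _ (hbd x)

/-- The exponential of a truncated variable is at most its linear part `1 + D z` plus an error of
order `|z|^p`, for every real `z`. -/
theorem exp_mul_clampOne_le {D p : ℝ} (hD : 0 ≤ D) (hp1 : 1 ≤ p) (hp2 : p ≤ 2) (z : ℝ) :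
    Real.exp (D * clampOne z) ≤ 1 + D * z + 2 * Real.exp (2 * D) * |z| ^ p := by
  have h2 : Real.exp (2 * D) = Real.exp D * Real.exp D := by rw [← Real.exp_add]; ring_nf
  have hq : 1 + D + D ^ 2 / 2 ≤ Real.exp D := Real.quadratic_le_exp_of_nonneg hD
  have hE1 : 1 ≤ Real.exp D := Real.one_le_exp hD
  rcases le_total |z| 1 with hz | hz
  · rw [clampOne_of_abs_le hz]
    -- `exp y - 1 - y ≤ y (exp y - 1) ≤ y² exp |y|`
    have hstep : ∀ y : ℝ, Real.exp y ≤ 1 + y + y ^ 2 * Real.exp |y| := by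
      intro y
      have h3 : Real.exp y - 1 ≤ y * Real.exp y := by
        have h4 := Real.add_one_le_exp (-y)
        have h5 : Real.exp y * Real.exp (-y) = 1 := by rw [← Real.exp_add]; simp
        nlinarith [Real.exp_pos y]
      have h6 : y ≤ Real.exp y - 1 := by linarith [Real.add_one_le_exp y]
      have h7 : 1 ≤ Real.exp |y| := Real.one_le_exp (abs_nonneg y)
      rcases le_total 0 y with h | h
      · rw [abs_of_nonneg h]
        nlinarith [Real.exp_pos y]
      · nlinarith [sq_nonneg y]
    have h3 : z ^ 2 ≤ |z| ^ p := by
      rw [← sq_abs, ← Real.rpow_natCast]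
      push_cast
      rcases (abs_nonneg z).eq_or_lt with h0 | h0
      · rw [← h0, Real.zero_rpow (by norm_num), Real.zero_rpow (by linarith)]
      · exact Real.rpow_le_rpow_of_exponent_ge h0 hz hp2
    have h4 : |D * z| ≤ D := by
      rw [abs_mul, abs_of_nonneg hD]
      exact mul_le_of_le_one_right hD hz
    have h5 : (D * z) ^ 2 * Real.exp |D * z| ≤ 2 * Real.exp (2 * D) * |z| ^ p := by
      calc (D * z) ^ 2 * Real.exp |D * z| ≤ (D * z) ^ 2 * Real.exp D := by
            gcongr
        _ = D ^ 2 * z ^ 2 * Real.exp D := by ring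
        _ ≤ (2 * Real.exp D) * |z| ^ p * Real.exp D := by gcongr; linarith
        _ = _ := by rw [h2]; ring
    linarith [hstep (D * z)]
  · have h3 : |z| ≤ |z| ^ p := by
      have := Real.rpow_le_rpow_of_exponent_le hz hp1
      rwa [Real.rpow_one] at this
    have h4 : D * clampOne z ≤ D := by
      have := (abs_le.1 (abs_clampOne_le z)).2
      nlinarith
    have h5 : Real.exp (D * clampOne z) ≤ Real.exp D := Real.exp_le_exp.2 h4
    have h6 : -(D * z) ≤ D * |z| := by
      have := neg_abs_le z
      nlinarith
    have h7 : Real.exp D + D * |z| ≤ 2 * Real.exp (2 * D) * |z| ^ p := by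
      have h8 : Real.exp D ≤ Real.exp (2 * D) * |z| ^ p := by
        rw [h2]; nlinarith
      have h9 : D * |z| ≤ Real.exp (2 * D) * |z| ^ p := by
        have : D ≤ Real.exp (2 * D) := by rw [h2]; nlinarith [sq_nonneg D]
        gcongr
      linarith
    linarith

/-- Exponential maximal inequality for one-sided partial sums of truncated variables. The factor
`sg` is a sign. -/
theorem IndepSeq.exponential_maximal {X : ℕ → Ω → ℝ} (hind : S.IndepSeq X)
    (hX : ∀ i, 1 ≤ i → X i ∈ S.H) {sg : ℝ} (hsg : |sg| = 1)
    (hmean : ∀ i, 1 ≤ i → S.E (fun ω => sg * X i ω) = 0) {p : ℝ} (hp1 : 1 ≤ p) (hp2 : p ≤ 2)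
    {M : ℝ} (hM : 0 ≤ M) (hmom : ∀ i, 1 ≤ i → S.nnE (fun ω => |X i ω| ^ p) ≤ ENNReal.ofReal M)
    {b : ℕ → ℝ} {n : ℕ} (hb : ∀ i, 1 ≤ i → i ≤ n → 0 ≤ b i) {D : ℝ} (hD : 0 < D) (x : ℝ) :
    S.nnE (ind {ω | ∃ j ∈ Finset.Icc 1 n,
        x < ∑ i ∈ Finset.Icc 1 j, clampOne (b i * (sg * X i ω))}) ≤
      ENNReal.ofReal (Real.exp
        (-(D * x) + 2 * Real.exp (2 * D) * M * ∑ i ∈ Finset.Icc 1 n, |b i| ^ p)) := by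
  have hK : 0 ≤ 2 * Real.exp (2 * D) := by positivity
  have hmax := hind.maximal_prod (h := fun i y => Real.exp (D * clampOne (b i * sg * y)))
    (fun i => Real.measurable_exp.comp ((measurable_clampOne.comp
      (measurable_id.const_mul _)).const_mul _))
    (fun i y => (Real.exp_pos _).le)
    (fun i hi => exp_mul_clampOne_mem (hX i hi) D (b i * sg))
    (m := fun i => 1 + 2 * Real.exp (2 * D) * |b i| ^ p * M)
    (fun i => by
      have : 0 ≤ 2 * Real.exp (2 * D) * |b i| ^ p * M := by positivity
      linarith) n
    (fun i hi hin => by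
      have hpow := abs_rpow_mem (hX i hi) hp1
      have hc : 0 ≤ 2 * Real.exp (2 * D) * |b i| ^ p := by positivity
      have h1 := nnE_le_of_le_one_add (S := S) (X := fun ω => sg * X i ω)
        (Z := fun ω => Real.exp (D * clampOne (b i * sg * X i ω)))
        (R := fun ω => 2 * Real.exp (2 * D) * |b i| ^ p * |X i ω| ^ p) (b := D * b i)
        (mul_nonneg hD.le (hb i hi hin)) (const_mul_mem sg (hX i hi))
        (exp_mul_clampOne_mem (hX i hi) D (b i * sg)) (const_mul_mem _ hpow)
        (fun ω => by positivity) (hmean i hi) (fun ω => by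
          have h2 := exp_mul_clampOne_le hD.le hp1 hp2 (b i * sg * X i ω)
          rw [abs_mul, abs_mul, hsg, mul_one, Real.mul_rpow (abs_nonneg _) (abs_nonneg _)] at h2
          linarith)
      refine h1.trans ?_
      rw [nnE_const_mul hc hpow, ENNReal.ofReal_add zero_le_one (by positivity),
        ENNReal.ofReal_one, ENNReal.ofReal_mul hc]
      gcongr
      exact hmom i hi)
    (lam := Real.exp (D * x)) (Real.exp_pos _).le
  have hset : {ω | ∃ j ∈ Finset.Icc 1 n, Real.exp (D * x) <
        ∏ i ∈ Finset.Icc 1 j, Real.exp (D * clampOne (b i * sg * X i ω))} =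
      {ω | ∃ j ∈ Finset.Icc 1 n, x < ∑ i ∈ Finset.Icc 1 j, clampOne (b i * (sg * X i ω))} := by
    ext ω
    simp only [Set.mem_ofPred_eq, ← Real.exp_sum, Real.exp_lt_exp, ← Finset.mul_sum, mul_assoc]
    simp only [mul_lt_mul_iff_right₀ hD]
  rw [hset] at hmax
  have hprod : ∏ i ∈ Finset.Icc 1 n, (1 + 2 * Real.exp (2 * D) * |b i| ^ p * M) ≤
      Real.exp (2 * Real.exp (2 * D) * M * ∑ i ∈ Finset.Icc 1 n, |b i| ^ p) := by
    rw [Finset.mul_sum, Real.exp_sum]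
    refine Finset.prod_le_prod (fun i _ => by positivity) fun i _ => ?_
    have := Real.add_one_le_exp (2 * Real.exp (2 * D) * M * |b i| ^ p)
    linarith
  have hpos : 0 < Real.exp (-(D * x)) := Real.exp_pos _
  have hone : ENNReal.ofReal (Real.exp (-(D * x))) * ENNReal.ofReal (Real.exp (D * x)) = 1 := by
    rw [← ENNReal.ofReal_mul hpos.le, ← Real.exp_add, neg_add_cancel, Real.exp_zero,
      ENNReal.ofReal_one]
  rw [Real.exp_add, ENNReal.ofReal_mul hpos.le, ← one_mul (S.nnE _), ← hone, mul_assoc]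
  gcongr
  exact hmax.trans (ENNReal.ofReal_le_ofReal hprod)

/-- An excess over `δ` is at most `δ` times the number of multiples of `δ` that are exceeded. -/
theorem nnE_excess_le (hS : S.CountablySubadditive) {X Z : Ω → ℝ} (hX : X ∈ S.H) (hZ : Z ∈ S.H)
    (hZ0 : ∀ ω, 0 ≤ Z ω) {δ B : ℝ} (hδ : 0 < δ) (hB : 0 < B)
    (h : ∀ ω, Z ω ≤ max (|X ω| / B - δ) 0) :
    S.nnE Z ≤ ENNReal.ofReal δ * ∑' k : ℕ, S.tail X (δ * B * (k + 1)) := by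
  have hY : ∀ k : ℕ, (fun ω => δ * ind {ω | δ * B * ((k : ℝ) + 1) < |X ω|} ω) ∈ S.H := fun k =>
    const_mul_mem δ (ind_mem (measurableSet_tail hX _))
  have hY0 : ∀ (k : ℕ) ω, 0 ≤ δ * ind {ω | δ * B * ((k : ℝ) + 1) < |X ω|} ω := fun k ω =>
    mul_nonneg hδ.le (ind_nonneg _ _)
  have h1 := hS Z (fun (k : ℕ) ω => δ * ind {ω | δ * B * ((k : ℝ) + 1) < |X ω|} ω) hZ hY hZ0 hY0
    fun ω => by
      set u : ℝ := |X ω| / (δ * B) with hu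
      refine le_trans ?_ (ENNReal.sum_le_tsum (Finset.range ⌈u - 1⌉₊))
      rw [← ENNReal.ofReal_sum_of_nonneg fun k _ => hY0 k ω]
      refine ENNReal.ofReal_le_ofReal ((h ω).trans ?_)
      have h2 : ∀ k ∈ Finset.range ⌈u - 1⌉₊,
          δ * ind {ω | δ * B * ((k : ℝ) + 1) < |X ω|} ω = δ := by
        intro k hk
        have h3 : (k : ℝ) < u - 1 := Nat.lt_ceil.1 (Finset.mem_range.1 hk)
        have h4 : (k : ℝ) + 1 < |X ω| / (δ * B) := by rw [← hu]; linarith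
        rw [lt_div_iff₀' (by positivity)] at h4
        have h6 : ω ∈ {ω | δ * B * ((k : ℝ) + 1) < |X ω|} := h4
        rw [ind_of_mem h6, mul_one]
      rw [Finset.sum_congr rfl h2, Finset.sum_const, Finset.card_range, nsmul_eq_mul]
      refine max_le ?_ (by positivity)
      have h5 : |X ω| / B = u * δ := by rw [hu]; field_simp
      rw [h5]
      have := Nat.le_ceil (u - 1)
      nlinarith
  refine h1.trans (le_of_eq ?_)
  rw [← ENNReal.tsum_mul_left]
  exact tsum_congr fun k => nnE_const_mul hδ.le (ind_mem (measurableSet_tail hX _))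

end SublinearExpectationSpace

/-! ### Excess of the maximal weighted sum -/

namespace SublinearExpectationSpace

variable {Ω : Type*} [MeasurableSpace Ω] {S : SublinearExpectationSpace Ω}

theorem maxWeightedSum_mem {X : ℕ → Ω → ℝ} (hX : ∀ i, 1 ≤ i → X i ∈ S.H) (a : ℕ → ℕ → ℝ)
    (n : ℕ+) : (fun ω => maxWeightedSum a X n ω) ∈ S.H :=
  sup'_mem _ _ fun _ _ => abs_mem (sum_mem _ fun i hi =>
    const_mul_mem _ (hX i (Finset.mem_Icc.1 hi).1))

theorem excess_mem {X : ℕ → Ω → ℝ} (hX : ∀ i, 1 ≤ i → X i ∈ S.H) (a : ℕ → ℕ → ℝ)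
    (n : ℕ+) (ε : ℝ) : (fun ω => max (maxWeightedSum a X n ω - ε) 0) ∈ S.H :=
  max_mem (sub_mem (maxWeightedSum_mem hX a n) (const_mem ε)) (const_mem 0)

theorem measurableSet_lt_maxWeightedSum {X : ℕ → Ω → ℝ} (hX : ∀ i, 1 ≤ i → X i ∈ S.H)
    (a : ℕ → ℕ → ℝ) (n : ℕ+) (ε : ℝ) : MeasurableSet {ω | ε < maxWeightedSum a X n ω} :=
  measurableSet_lt measurable_const (S.measurable_of_mem _ (maxWeightedSum_mem hX a n))

/-- Markov's inequality for the maximal weighted sum. -/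
theorem ofReal_mul_capacity_maxWeightedSum_le {X : ℕ → Ω → ℝ} (hX : ∀ i, 1 ≤ i → X i ∈ S.H)
    (a : ℕ → ℕ → ℝ) (n : ℕ+) {ε : ℝ} (hε : 0 ≤ ε) :
    ENNReal.ofReal ε * S.nnE (ind {ω | 2 * ε < maxWeightedSum a X n ω}) ≤
      S.nnE (fun ω => max (maxWeightedSum a X n ω - ε) 0) := by
  refine ofReal_mul_nnE_ind_le (measurableSet_lt_maxWeightedSum hX a n _) (excess_mem hX a n ε) hε
    (fun ω => le_max_right _ _) fun ω hω => le_max_of_le_left ?_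
  have : 2 * ε < maxWeightedSum a X n ω := hω
  linarith

/-- The maximal weighted sum is split into the sum of the truncated terms, bounded by `n δ` and
exceeding `ε` only on an event of exponentially small capacity, and the excesses of the single
terms over `δ`. -/
theorem nnE_excess_maxWeightedSum_le {X : ℕ → Ω → ℝ} (hind : S.IndepSeq X)
    (hX : ∀ i, 1 ≤ i → X i ∈ S.H) (hmean : ∀ i, 1 ≤ i → S.E (X i) = 0 ∧ -S.E (fun ω => -X i ω) = 0)
    {p : ℝ} (hp1 : 1 ≤ p) (hp2 : p ≤ 2) {M : ℝ} (hM : 0 ≤ M)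
    (hmom : ∀ i, 1 ≤ i → S.nnE (fun ω => |X i ω| ^ p) ≤ ENNReal.ofReal M)
    {a : ℕ → ℕ → ℝ} (ha : ∀ n i, 1 ≤ i → i ≤ n → 0 < a n i) (n : ℕ+) {D δ ε : ℝ}
    (hD : 0 < D) (hδ : 0 < δ) (hε : 0 ≤ ε) :
    S.nnE (fun ω => max (maxWeightedSum a X n ω - ε) 0) ≤
      ENNReal.ofReal (n * δ) * (2 * ENNReal.ofReal (Real.exp (-(D * (ε / δ)) +
        2 * Real.exp (2 * D) * M * ∑ i ∈ Finset.Icc 1 (n : ℕ), |a n i / δ| ^ p))) +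
      ∑ i ∈ Finset.Icc 1 (n : ℕ), S.nnE (fun ω => max (|a n i * X i ω| - δ) 0) := by
  let A : ℝ → Set Ω := fun sg => {ω | ∃ j ∈ Finset.Icc 1 (n : ℕ),
    ε / δ < ∑ i ∈ Finset.Icc 1 j, clampOne (a n i / δ * (sg * X i ω))}
  have hA : ∀ sg, MeasurableSet (A sg) := fun sg => by
    have : A sg = ⋃ j ∈ Finset.Icc 1 (n : ℕ),
        {ω | ε / δ < ∑ i ∈ Finset.Icc 1 j, clampOne (a n i / δ * (sg * X i ω))} := by
      ext; simp [A]
    rw [this]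
    refine Finset.measurableSet_biUnion _ fun j _ => measurableSet_lt measurable_const ?_
    refine Finset.measurable_sum _ fun i hi => measurable_clampOne.comp ?_
    exact ((S.measurable_of_mem _ (hX i (Finset.mem_Icc.1 hi).1)).const_mul _).const_mul _
  have hcap : ∀ sg : ℝ, |sg| = 1 → (∀ i, 1 ≤ i → S.E (fun ω => sg * X i ω) = 0) →
      S.nnE (ind (A sg)) ≤ ENNReal.ofReal (Real.exp (-(D * (ε / δ)) +
        2 * Real.exp (2 * D) * M * ∑ i ∈ Finset.Icc 1 (n : ℕ), |a n i / δ| ^ p)) :=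
    fun sg hsg hE => hind.exponential_maximal hX hsg hE hp1 hp2 hM hmom
      (b := fun i => a n i / δ) (fun i hi hin => div_nonneg (ha n i hi hin).le hδ.le) hD (ε / δ)
  have h1 := hcap 1 (by simp) fun i hi => by simpa using (hmean i hi).1
  have h2 := hcap (-1) (by simp) fun i hi => by simpa using (hmean i hi).2
  have hU := (hA 1).union (hA (-1))
  have hRH : ∀ i ∈ Finset.Icc 1 (n : ℕ), (fun ω => max (|a n i * X i ω| - δ) 0) ∈ S.H :=
    fun i hi => max_mem (sub_mem (abs_mem (const_mul_mem _ (hX i (Finset.mem_Icc.1 hi).1)))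
      (const_mem δ)) (const_mem 0)
  have hnδ : (0 : ℝ) ≤ n * δ := by positivity
  have hpt : ∀ ω, max (maxWeightedSum a X n ω - ε) 0 ≤ n * δ * ind (A 1 ∪ A (-1)) ω +
      ∑ i ∈ Finset.Icc 1 (n : ℕ), max (|a n i * X i ω| - δ) 0 := by
    intro ω
    have hsum0 : 0 ≤ ∑ i ∈ Finset.Icc 1 (n : ℕ), max (|a n i * X i ω| - δ) 0 :=
      Finset.sum_nonneg fun i _ => le_max_right _ _
    refine max_le ?_ (add_nonneg (mul_nonneg hnδ (ind_nonneg _ _)) hsum0)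
    rw [sub_le_iff_le_add]
    refine Finset.sup'_le _ _ fun j hj => ?_
    have hj' := Finset.mem_Icc.1 hj
    set T : ℝ := ∑ i ∈ Finset.Icc 1 j, clampOne (a n i / δ * X i ω) with hT
    have hdiff : |∑ i ∈ Finset.Icc 1 j, a n i * X i ω - δ * T| ≤
        ∑ i ∈ Finset.Icc 1 (n : ℕ), max (|a n i * X i ω| - δ) 0 := by
      rw [hT, Finset.mul_sum, ← Finset.sum_sub_distrib]
      refine (Finset.abs_sum_le_sum_abs _ _).trans ?_
      refine le_trans (Finset.sum_le_sum fun i _ => ?_) (Finset.sum_le_sum_of_subset_of_nonneg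
        (Finset.Icc_subset_Icc_right hj'.2) fun i _ _ => le_max_right (|a n i * X i ω| - δ) 0)
      have h3 := abs_sub_clampOne (a n i / δ * X i ω)
      have h4 : a n i * X i ω - δ * clampOne (a n i / δ * X i ω) =
          δ * (a n i / δ * X i ω - clampOne (a n i / δ * X i ω)) := by field_simp
      have h5 : |a n i * X i ω| = δ * |a n i / δ * X i ω| := by
        rw [← abs_of_pos hδ, ← abs_mul, abs_of_pos hδ]; congr 1; field_simp
      rw [h4, abs_mul, abs_of_pos hδ, h3, h5, mul_max_of_nonneg _ _ hδ.le, mul_zero, mul_sub, mul_one]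
    have htri : |∑ i ∈ Finset.Icc 1 j, a n i * X i ω| ≤ δ * |T| +
        ∑ i ∈ Finset.Icc 1 (n : ℕ), max (|a n i * X i ω| - δ) 0 := by
      have h3 := abs_sub_abs_le_abs_sub (∑ i ∈ Finset.Icc 1 j, a n i * X i ω) (δ * T)
      rw [abs_mul δ T, abs_of_pos hδ] at h3
      linarith
    by_cases hω : ω ∈ A 1 ∪ A (-1)
    · rw [ind_of_mem hω]
      have h3 : |T| ≤ n := by
        refine (Finset.abs_sum_le_sum_abs _ _).trans
          ((Finset.sum_le_sum fun i _ => abs_clampOne_le _).trans ?_)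
        simp only [Finset.sum_const, Nat.card_Icc, Nat.add_sub_cancel, nsmul_eq_mul, mul_one]
        exact_mod_cast hj'.2
      nlinarith
    · have h3 : |T| ≤ ε / δ := by
        refine abs_le'.2 ⟨not_lt.1 fun h => hω (Set.mem_union_left _ ⟨j, hj, ?_⟩),
          not_lt.1 fun h => hω (Set.mem_union_right _ ⟨j, hj, ?_⟩)⟩
        · simpa only [one_mul] using h
        · simpa only [neg_one_mul, mul_neg, clampOne_neg, Finset.sum_neg_distrib] using h
      rw [le_div_iff₀' hδ] at h3
      have := mul_nonneg hnδ (ind_nonneg (A 1 ∪ A (-1)) ω)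
      linarith
  refine (nnE_mono (excess_mem hX a n ε) (add_mem (const_mul_mem _ (ind_mem hU)) (sum_mem _ hRH))
    hpt).trans ?_
  refine (nnE_add_le (const_mul_mem _ (ind_mem hU)) (sum_mem _ hRH)
    (fun ω => mul_nonneg hnδ (ind_nonneg _ _))
    (fun ω => Finset.sum_nonneg fun i _ => le_max_right _ _)).trans ?_
  rw [nnE_const_mul hnδ (ind_mem hU)]
  gcongr
  · rw [two_mul]
    exact (nnE_ind_union_le (hA 1) (hA (-1))).trans (add_le_add h1 h2)
  · exact nnE_sum_le _ hRH fun i _ ω => le_max_right _ _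

/-- Moments of order `p ≤ r` are finite and bounded along an identically distributed sequence. -/
theorem exists_moment_bound (hS : S.CountablySubadditive) {X₀ : Ω → ℝ} (hX₀ : X₀ ∈ S.H)
    {X : ℕ → Ω → ℝ} (hX : ∀ i, 1 ≤ i → X i ∈ S.H) (hident : ∀ i, 1 ≤ i → S.IdentDistrib (X i) X₀)
    {q r p : ℝ} (hp1 : 1 ≤ p) (hpr : p ≤ r)
    (hJ : ∫⁻ x in Set.Ioi (0 : ℝ), S.nnE (ind {ω | x < growth q r |X₀ ω|}) < ⊤) :
    ∃ M : ℝ, 0 ≤ M ∧ ∀ i, 1 ≤ i → S.nnE (fun ω => |X i ω| ^ p) ≤ ENNReal.ofReal M := by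
  set J := ∫⁻ x in Set.Ioi (0 : ℝ), S.nnE (ind {ω | x < growth q r |X₀ ω|}) with hJdef
  set K := ENNReal.ofReal (Real.log 2)⁻¹ * (2 + J) with hK
  have hKfin : K ≠ ⊤ := (ENNReal.mul_lt_top ENNReal.ofReal_lt_top
    (ENNReal.add_lt_top.2 ⟨ENNReal.ofNat_lt_top, hJ⟩)).ne
  refine ⟨K.toReal, ENNReal.toReal_nonneg, fun i hi => ?_⟩
  rw [ENNReal.ofReal_toReal hKfin]
  have h2 : 0 < Real.log 2 := Real.log_pos (by norm_num)
  have h1 := nnE_le_choquet hS (abs_rpow_mem (hX i hi) hp1) (fun ω => by positivity)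
    (W := fun ω => growth q r |X i ω|)
    ((measurable_growth q r).comp (S.measurable_of_mem _ (abs_mem (hX i hi))))
    (inv_nonneg.2 h2.le)
    (fun ω => rpow_le_growth (by linarith) (abs_nonneg _) (by linarith) hpr)
  have h3 : ∀ x : ℝ, S.nnE (ind {ω | x < growth q r |X i ω|}) =
      S.nnE (ind {ω | x < growth q r |X₀ ω|}) := fun x =>
    (hident i hi).nnE_ind (hX i hi) hX₀ (B := {y | x < growth q r |y|})
      (measurableSet_lt measurable_const ((measurable_growth q r).comp _root_.measurable_abs))
  simpa only [h3] using h1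

theorem tsum_lt_top_of_le {ι : Type*} {f g : ι → ℝ≥0∞} (s : Finset ι) (hf : ∀ n ∈ s, f n < ⊤)
    (hfg : ∀ n ∉ s, f n ≤ g n) (hg : ∑' n, g n < ⊤) : ∑' n, f n < ⊤ := by
  classical
  have h1 : ∀ n, f n ≤ (if n ∈ s then f n else 0) + g n := fun n => by
    by_cases h : n ∈ s
    · rw [if_pos h]; exact le_self_add
    · rw [if_neg h, zero_add]; exact hfg n h
  refine (ENNReal.tsum_le_tsum h1).trans_lt ?_
  rw [ENNReal.tsum_add, tsum_eq_sum (s := s) fun n hn => if_neg hn]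
  refine ENNReal.add_lt_top.2 ⟨ENNReal.sum_lt_top.2 fun n hn => ?_, hg⟩
  rw [if_pos hn]
  exact hf n hn

theorem capacitySeries_lt_top {X : ℕ → Ω → ℝ} (hX : ∀ i, 1 ≤ i → X i ∈ S.H) {a : ℕ → ℕ → ℝ}
    {r ε : ℝ} (hε : 0 < ε) (h : momentSeries S r a X ε < ⊤) :
    capacitySeries S r a X (2 * ε) < ⊤ := by
  have h1 : capacitySeries S r a X (2 * ε) ≤ ENNReal.ofReal ε⁻¹ * momentSeries S r a X ε := by
    unfold capacitySeries momentSeries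
    rw [← ENNReal.tsum_mul_left]
    refine ENNReal.tsum_le_tsum fun n => ?_
    rw [toENNReal_capacity (measurableSet_lt_maxWeightedSum hX a n _), mul_left_comm]
    gcongr
    have h2 := ofReal_mul_capacity_maxWeightedSum_le hX a n hε.le
    calc _ = ENNReal.ofReal ε⁻¹ * (ENNReal.ofReal ε *
          S.nnE (ind {ω | 2 * ε < maxWeightedSum a X n ω})) := by
            rw [← mul_assoc, ← ENNReal.ofReal_mul (by positivity), inv_mul_cancel₀ hε.ne',
              ENNReal.ofReal_one, one_mul]
      _ ≤ _ := by gcongr; exact h2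
  exact h1.trans_lt (ENNReal.mul_lt_top ENNReal.ofReal_lt_top h)

end SublinearExpectationSpace

/-! ### Convergence of the moment series -/

namespace SublinearExpectationSpace

variable {Ω : Type*} [MeasurableSpace Ω] {S : SublinearExpectationSpace Ω}

/-- The moment condition implies convergence of the moment series. The excesses over `δ` are summed
by `tsum_tail_lt_top`. In the exponential bound `D` is chosen as a multiple of `log n` such that
`exp (2 D)` compensates the decay `n^(-κ)` of `∑ i, (a n i)^p`, and `δ` is chosen so small that the
bound is of order `n^(-(r + 1))`. -/
theorem momentSeries_lt_top (hS : S.CountablySubadditive) {β r : ℝ} (hβ : -1 < β) (hr : 1 < r)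
    {X₀ : Ω → ℝ} (hX₀ : X₀ ∈ S.H) {X : ℕ → Ω → ℝ} (hX : ∀ i, 1 ≤ i → X i ∈ S.H)
    (hindep : S.IndepSeq X) (hident : ∀ i, 1 ≤ i → S.IdentDistrib (X i) X₀)
    (hmean : ∀ i, 1 ≤ i → S.E (X i) = 0 ∧ -S.E (fun ω => -X i ω) = 0)
    {a : ℕ → ℕ → ℝ} (ha_pos : ∀ n i, 1 ≤ i → i ≤ n → 0 < a n i)
    (ha : ArrayLL a fun n i => ((i : ℝ) / (n : ℝ)) ^ β * (1 / (n : ℝ)))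
    (ha_sum : ∀ n, 1 ≤ n → ∑ i ∈ Finset.Icc 1 n, a n i = 1)
    (hJ : ∫⁻ x in Set.Ioi (0 : ℝ),
      S.nnE (ind {ω | x < growth ((r - 1) / (1 + β)) r |X₀ ω|}) < ⊤)
    {ε : ℝ} (hε : 0 < ε) : momentSeries S r a X ε < ⊤ := by
  obtain ⟨C, hC, hev⟩ := ha
  obtain ⟨N₀, hN₀⟩ := eventually_atTop.1 hev
  set γ : ℝ := 1 + β with hγ
  have hγ0 : 0 < γ := by linarith
  set ρ : ℝ := min 1 γ with hρ
  have hρ0 : 0 < ρ := lt_min one_pos hγ0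
  set p : ℝ := min r 2 with hp
  have hp1 : 1 < p := lt_min hr (by norm_num)
  have hp2 : p ≤ 2 := min_le_right _ _
  set κ : ℝ := ρ * (p - 1) with hκ
  have hκ0 : 0 < κ := mul_pos hρ0 (by linarith)
  set δ : ℝ := κ * ε / (2 * (r + 1)) with hδ
  have hr1 : 0 < r + 1 := by linarith
  have hδ0 : 0 < δ := by positivity
  obtain ⟨M, hM0, hM⟩ := exists_moment_bound hS hX₀ hX hident hp1.le (min_le_left r 2) hJ
  obtain ⟨M₁, hM₁0, hM₁⟩ := exists_moment_bound hS hX₀ hX hident le_rfl hr.le hJ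
  simp only [Real.rpow_one] at hM₁
  set Q : ℝ := 2 * M * (δ⁻¹ ^ p * C ^ (p - 1)) with hQ
  set b : ℝ := δ * C⁻¹ with hb
  have hb0 : 0 < b := by positivity
  have hzlt := tsum_tail_lt_top hX₀ hγ0 hr hJ hb0
  let G : ℕ → ℝ≥0∞ := fun n => ∑' (i : ℕ) (k : ℕ),
    pairWeight r (n, i) * S.tail X₀ (b * (k + 1) * wscale γ n i)
  have hG : ∑' n, G n < ⊤ := by
    rw [ENNReal.tsum_prod', ENNReal.tsum_comm, ENNReal.tsum_prod'] at hzlt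
    exact hzlt
  let N : ℕ+ := ⟨max N₀ 2, by positivity⟩
  refine tsum_lt_top_of_le (Finset.Iio N)
    (g := fun n : ℕ+ => ENNReal.ofReal (2 * δ * Real.exp Q) * ENNReal.ofReal ((n : ℝ) ^ (-2 : ℝ)) +
      ENNReal.ofReal δ * G n) (fun n _ => ?_) (fun n hn => ?_) ?_
  · -- every single term is finite because the weighted sums have a finite first moment
    refine ENNReal.mul_lt_top ENNReal.ofReal_lt_top ?_
    have hmem : ∀ i ∈ Finset.Icc 1 (n : ℕ), (fun ω => a n i * |X i ω|) ∈ S.H := fun i hi =>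
      const_mul_mem _ (abs_mem (hX i (Finset.mem_Icc.1 hi).1))
    have hnonneg : ∀ i ∈ Finset.Icc 1 (n : ℕ), ∀ ω, 0 ≤ a n i * |X i ω| := fun i hi ω =>
      mul_nonneg (ha_pos n i (Finset.mem_Icc.1 hi).1 (Finset.mem_Icc.1 hi).2).le (abs_nonneg _)
    refine lt_of_le_of_lt ((nnE_mono (excess_mem hX a n ε) (sum_mem _ hmem) fun ω => ?_).trans
      (nnE_sum_le _ hmem hnonneg)) (ENNReal.sum_lt_top.2 fun i hi => ?_)
    · refine max_le ?_ (Finset.sum_nonneg fun i hi => hnonneg i hi ω)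
      rw [sub_le_iff_le_add]
      refine Finset.sup'_le _ _ fun j hj => ?_
      refine (Finset.abs_sum_le_sum_abs _ _).trans ?_
      have h1 : ∑ i ∈ Finset.Icc 1 j, |a n i * X i ω| ≤
          ∑ i ∈ Finset.Icc 1 (n : ℕ), |a n i * X i ω| :=
        Finset.sum_le_sum_of_subset_of_nonneg
          (Finset.Icc_subset_Icc_right (Finset.mem_Icc.1 hj).2) fun i _ _ => abs_nonneg _
      have h2 : ∑ i ∈ Finset.Icc 1 (n : ℕ), |a n i * X i ω| =
          ∑ i ∈ Finset.Icc 1 (n : ℕ), a n i * |X i ω| := Finset.sum_congr rfl fun i hi => by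
        rw [abs_mul, abs_of_pos (ha_pos n i (Finset.mem_Icc.1 hi).1 (Finset.mem_Icc.1 hi).2)]
      linarith
    · rw [Finset.mem_Icc] at hi
      rw [nnE_const_mul (ha_pos n i hi.1 hi.2).le (abs_mem (hX i hi.1))]
      exact ENNReal.mul_lt_top ENNReal.ofReal_lt_top ((hM₁ i hi.1).trans_lt ENNReal.ofReal_lt_top)
  · have hnN : max N₀ 2 ≤ (n : ℕ) := by
      have : N ≤ n := by simpa using hn
      exact_mod_cast this
    have hn2 : (2 : ℝ) ≤ n := by exact_mod_cast (le_max_right N₀ 2).trans hnN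
    have hn0 : (0 : ℝ) < n := by linarith
    have han : ∀ i, 1 ≤ i → i ≤ (n : ℕ) → a n i ≤ C * (wscale γ n i)⁻¹ := fun i hi hin => by
      rw [← weight_eq_inv_wscale β hi hin]
      exact hN₀ n ((le_max_left N₀ 2).trans hnN) i hi hin
    have hlog : 0 < Real.log n := Real.log_pos (by linarith)
    set D : ℝ := κ / 2 * Real.log n with hD
    have hD0 : 0 < D := by positivity
    have hexpD : Real.exp (2 * D) = (n : ℝ) ^ κ := by
      rw [Real.rpow_def_of_pos hn0, hD]; congr 1; ring
    have hsum : ∑ i ∈ Finset.Icc 1 (n : ℕ), |a n i / δ| ^ p ≤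
        δ⁻¹ ^ p * C ^ (p - 1) * (n : ℝ) ^ (-κ) := by
      have hterm : ∀ i ∈ Finset.Icc 1 (n : ℕ), |a n i / δ| ^ p ≤
          δ⁻¹ ^ p * C ^ (p - 1) * (n : ℝ) ^ (-κ) * a n i := by
        intro i hi
        rw [Finset.mem_Icc] at hi
        have hai := ha_pos n i hi.1 hi.2
        have h1 : a n i ≤ C * (n : ℝ) ^ (-ρ) := by
          refine (han i hi.1 hi.2).trans ?_
          rw [Real.rpow_neg hn0.le]
          gcongr
          exact rpow_min_le_wscale γ hi.1 hi.2
        have h2 : (a n i) ^ p = (a n i) ^ (p - 1) * a n i := by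
          rw [← Real.rpow_add_one hai.ne']; ring_nf
        have h3 : (a n i) ^ (p - 1) ≤ C ^ (p - 1) * (n : ℝ) ^ (-κ) := by
          refine (Real.rpow_le_rpow hai.le h1 (by linarith)).trans_eq ?_
          rw [Real.mul_rpow hC.le (by positivity), ← Real.rpow_mul hn0.le, hκ, neg_mul]
        rw [abs_of_pos (by positivity), div_eq_mul_inv, Real.mul_rpow hai.le (by positivity), h2]
        calc (a n i) ^ (p - 1) * a n i * δ⁻¹ ^ p
            ≤ C ^ (p - 1) * (n : ℝ) ^ (-κ) * a n i * δ⁻¹ ^ p := by gcongr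
          _ = _ := by ring
      refine (Finset.sum_le_sum hterm).trans_eq ?_
      rw [← Finset.mul_sum, ha_sum n n.pos, mul_one]
    have hexp : Real.exp (-(D * (ε / δ)) +
        2 * Real.exp (2 * D) * M * ∑ i ∈ Finset.Icc 1 (n : ℕ), |a n i / δ| ^ p) ≤
        (n : ℝ) ^ (-(r + 1)) * Real.exp Q := by
      rw [Real.rpow_def_of_pos hn0, ← Real.exp_add]
      refine Real.exp_le_exp.2 (add_le_add (le_of_eq ?_) ?_)
      · rw [hD, hδ]; field_simp
      · rw [hexpD]
        calc 2 * (n : ℝ) ^ κ * M * ∑ i ∈ Finset.Icc 1 (n : ℕ), |a n i / δ| ^ p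
            ≤ 2 * (n : ℝ) ^ κ * M * (δ⁻¹ ^ p * C ^ (p - 1) * (n : ℝ) ^ (-κ)) := by gcongr
          _ = Q * ((n : ℝ) ^ κ * (n : ℝ) ^ (-κ)) := by rw [hQ]; ring
          _ = Q := by rw [← Real.rpow_add hn0, add_neg_cancel, Real.rpow_zero, mul_one]
    have hmain := nnE_excess_maxWeightedSum_le hindep hX hmean hp1.le hp2 hM0 hM ha_pos n hD0 hδ0
      hε.le
    have hexc : ∀ i ∈ Finset.Icc 1 (n : ℕ), S.nnE (fun ω => max (|a n i * X i ω| - δ) 0) ≤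
        ENNReal.ofReal δ * ∑' k : ℕ, S.tail X₀ (b * (k + 1) * wscale γ n i) := by
      intro i hi
      rw [Finset.mem_Icc] at hi
      have hw := wscale_pos γ hi.1 hi.2
      have h1 := nnE_excess_le hS (hX i hi.1) (Z := fun ω => max (|a n i * X i ω| - δ) 0)
        (max_mem (sub_mem (abs_mem (const_mul_mem _ (hX i hi.1))) (const_mem δ)) (const_mem 0))
        (fun ω => le_max_right _ _) hδ0 (B := C⁻¹ * wscale γ n i) (by positivity) fun ω => by
          have h2 : |a n i * X i ω| ≤ |X i ω| / (C⁻¹ * wscale γ n i) := by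
            rw [abs_mul, abs_of_pos (ha_pos n i hi.1 hi.2), div_eq_mul_inv, mul_inv, inv_inv, mul_comm]
            exact mul_le_mul_of_nonneg_left (han i hi.1 hi.2) (abs_nonneg _)
          exact max_le_max (by linarith) le_rfl
      refine h1.trans (le_of_eq ?_)
      congr 1
      refine tsum_congr fun k => ?_
      rw [(hident i hi.1).tail_eq (hX i hi.1) hX₀, hb]
      congr 1; ring
    have hfirst : ENNReal.ofReal ((n : ℝ) ^ (r - 2)) * (ENNReal.ofReal (n * δ) *
        (2 * ENNReal.ofReal ((n : ℝ) ^ (-(r + 1)) * Real.exp Q))) =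
        ENNReal.ofReal (2 * δ * Real.exp Q) * ENNReal.ofReal ((n : ℝ) ^ (-2 : ℝ)) := by
      rw [← ENNReal.ofReal_ofNat, ← ENNReal.ofReal_mul (by positivity),
        ← ENNReal.ofReal_mul (by positivity), ← ENNReal.ofReal_mul (by positivity),
        ← ENNReal.ofReal_mul (by positivity)]
      congr 1
      have : (n : ℝ) ^ (-2 : ℝ) = (n : ℝ) ^ (r - 2) * n * (n : ℝ) ^ (-(r + 1)) := by
        rw [← Real.rpow_add_one hn0.ne', ← Real.rpow_add hn0]; ring_nf
      rw [this]; ring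
    refine (mul_le_mul_right (hmain.trans (add_le_add (mul_le_mul_right (mul_le_mul_right
      (ENNReal.ofReal_le_ofReal hexp) _) _) (Finset.sum_le_sum hexc))) _).trans ?_
    rw [mul_add, hfirst]
    refine add_le_add le_rfl ?_
    rw [← Finset.mul_sum, mul_left_comm]
    refine mul_le_mul' le_rfl ?_
    rw [Finset.mul_sum]
    refine le_trans (Finset.sum_le_sum fun i hi => ?_) (ENNReal.sum_le_tsum (Finset.Icc 1 (n : ℕ)))
    rw [ENNReal.tsum_mul_left, pairWeight, if_pos (Finset.mem_Icc.1 hi)]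
  · rw [ENNReal.tsum_add, ENNReal.tsum_mul_left, ENNReal.tsum_mul_left]
    have h1 : ∑' n : ℕ+, G n ≤ ∑' n, G n :=
      ENNReal.tsum_comp_le_tsum_of_injective PNat.coe_injective G
    have h2 : ∑' n : ℕ+, ENNReal.ofReal ((n : ℝ) ^ (-2 : ℝ)) ≤
        ∑' n : ℕ, ENNReal.ofReal ((n : ℝ) ^ (-2 : ℝ)) :=
      ENNReal.tsum_comp_le_tsum_of_injective PNat.coe_injective
        fun n : ℕ => ENNReal.ofReal ((n : ℝ) ^ (-2 : ℝ))
    have h3 : ∑' n : ℕ, ENNReal.ofReal ((n : ℝ) ^ (-2 : ℝ)) < ⊤ := by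
      rw [← ENNReal.ofReal_tsum_of_nonneg (fun n => by positivity)
        (Real.summable_nat_rpow.2 (by norm_num))]
      exact ENNReal.ofReal_lt_top
    exact ENNReal.add_lt_top.2 ⟨ENNReal.mul_lt_top ENNReal.ofReal_lt_top (h2.trans_lt h3),
      ENNReal.mul_lt_top ENNReal.ofReal_lt_top (h1.trans_lt hG)⟩

end SublinearExpectationSpace

/-! ### Necessity of the moment condition -/

namespace SublinearExpectationSpace

theorem abs_term_le_two_mul_maxWeightedSum {Ω : Type*} (X : ℕ → Ω → ℝ) (a : ℕ → ℕ → ℝ) (n : ℕ+)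
    (ω : Ω) {i : ℕ} (hi : i ∈ Finset.Icc 1 (n : ℕ)) :
    |a n i * X i ω| ≤ 2 * maxWeightedSum a X n ω := by
  have hle : ∀ j ∈ Finset.Icc 1 (n : ℕ),
      |∑ i ∈ Finset.Icc 1 j, a n i * X i ω| ≤ maxWeightedSum a X n ω := fun j hj =>
    Finset.le_sup' (fun j => |∑ i ∈ Finset.Icc 1 j, a n i * X i ω|) hj
  have h0 : 0 ≤ maxWeightedSum a X n ω := (abs_nonneg _).trans (hle i hi)
  rw [Finset.mem_Icc] at hi
  obtain ⟨k, rfl⟩ : ∃ k, i = k + 1 := ⟨i - 1, by omega⟩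
  have h1 := hle (k + 1) (Finset.mem_Icc.2 hi)
  have h2 : |∑ i ∈ Finset.Icc 1 k, a n i * X i ω| ≤ maxWeightedSum a X n ω := by
    rcases Nat.eq_zero_or_pos k with rfl | hk
    · simpa using h0
    · exact hle k (Finset.mem_Icc.2 ⟨hk, by omega⟩)
  rw [Finset.sum_Icc_succ_top (by omega)] at h1
  have h3 := abs_sub (∑ i ∈ Finset.Icc 1 k, a n i * X i ω + a n (k + 1) * X (k + 1) ω)
    (∑ i ∈ Finset.Icc 1 k, a n i * X i ω)
  rw [add_sub_cancel_left] at h3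
  linarith

theorem tsum_nat_lt_top_of_tsum_pnat {F : ℕ → ℝ≥0∞} (h0 : F 0 = 0)
    (h : ∑' n : ℕ+, F n < ⊤) : ∑' n, F n < ⊤ := by
  rw [tsum_eq_zero_add' ENNReal.summable, h0, zero_add]
  rwa [tsum_pnat_eq_tsum_succ (f := F)] at h

variable {Ω : Type*} [MeasurableSpace Ω] {S : SublinearExpectationSpace Ω}

/-- The event that `|X i| > b * wscale γ n i` for some `i ≤ n`, that is, that one of the first `n`
weighted terms exceeds a threshold of order `b`. -/
def exceedSet (X : ℕ → Ω → ℝ) (γ b : ℝ) (n : ℕ) : Set Ω :=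
  {ω | ∃ i ∈ Finset.Icc 1 n, b * wscale γ n i < |X i ω|}

theorem measurableSet_exceedSet {X : ℕ → Ω → ℝ} (hX : ∀ i, 1 ≤ i → X i ∈ S.H) (γ b : ℝ) (n : ℕ) :
    MeasurableSet (exceedSet X γ b n) := by
  have : exceedSet X γ b n = ⋃ i ∈ Finset.Icc 1 n, {ω | b * wscale γ n i < |X i ω|} := by
    ext; simp [exceedSet]
  rw [this]
  exact Finset.measurableSet_biUnion _ fun i hi =>
    measurableSet_tail (hX i (Finset.mem_Icc.1 hi).1) _

theorem tsum_exceedSet_lt_top {β r : ℝ} {X : ℕ → Ω → ℝ} (hX : ∀ i, 1 ≤ i → X i ∈ S.H)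
    {a : ℕ → ℕ → ℝ} (ha_pos : ∀ n i, 1 ≤ i → i ≤ n → 0 < a n i)
    (ha : ArrayLL (fun n i => ((i : ℝ) / (n : ℝ)) ^ β * (1 / (n : ℝ))) a)
    (hseries : ∀ ε : ℝ, 0 < ε → momentSeries S r a X ε < ⊤) {b : ℝ} (hb : 0 < b) :
    ∑' n : ℕ, ENNReal.ofReal ((n : ℝ) ^ (r - 2)) *
      S.nnE (ind (exceedSet X (1 + β) b n)) < ⊤ := by
  obtain ⟨C, hC, hev⟩ := ha
  obtain ⟨N₀, hN₀⟩ := eventually_atTop.1 hev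
  have hcap := capacitySeries_lt_top hX (ε := b / (4 * C)) (by positivity)
    (hseries _ (by positivity))
  refine tsum_nat_lt_top_of_tsum_pnat ?_ ?_
  · have : (ind (exceedSet X (1 + β) b 0)) = fun _ => 0 :=
      funext fun ω => ind_of_notMem (by simp [exceedSet])
    rw [this, nnE_const, ENNReal.ofReal_zero, mul_zero]
  let N : ℕ+ := ⟨N₀ + 1, Nat.succ_pos _⟩
  refine tsum_lt_top_of_le (Finset.Iio N) (fun n _ => ENNReal.mul_lt_top ENNReal.ofReal_lt_top
    (nnE_ind_ne_top (measurableSet_exceedSet hX _ _ _)).lt_top) (fun n hn => ?_) hcap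
  have hnN : N₀ ≤ (n : ℕ) := by
    have h1 : N ≤ n := by simpa using hn
    have h2 : N₀ + 1 ≤ (n : ℕ) := by exact_mod_cast h1
    omega
  gcongr
  rw [toENNReal_capacity (measurableSet_lt_maxWeightedSum hX a n _)]
  -- `a n i * |X i| > b / C`, while every term is at most twice the maximal partial sum
  refine nnE_ind_mono (measurableSet_exceedSet hX _ _ _) (measurableSet_lt_maxWeightedSum hX a n _) ?_
  rintro ω ⟨i, hi, hlt⟩
  have hi' := Finset.mem_Icc.1 hi
  have h1 := abs_term_le_two_mul_maxWeightedSum X a n ω hi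
  have hai := ha_pos n i hi'.1 hi'.2
  have h2 := (weight_eq_inv_wscale β hi'.1 hi'.2).symm.le.trans (hN₀ n hnN i hi'.1 hi'.2)
  have hw := wscale_pos (1 + β) hi'.1 hi'.2
  have h3 : 1 ≤ C * a n i * wscale (1 + β) n i := by
    have := mul_le_mul_of_nonneg_right h2 hw.le
    rwa [inv_mul_cancel₀ hw.ne'] at this
  rw [abs_mul, abs_of_pos hai] at h1
  have h4 : a n i * (b * wscale (1 + β) n i) < a n i * |X i ω| := by gcongr
  show 2 * (b / (4 * C)) < maxWeightedSum a X n ω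
  have h5 : b / C ≤ a n i * (b * wscale (1 + β) n i) := by
    rw [div_le_iff₀ hC]
    nlinarith
  have h6 : 2 * (b / (4 * C)) = b / C / 2 := by ring
  rw [h6]
  linarith

/-- On a dyadic block `[N, 2 N)` the scales are comparable and the weights `m^(r - 2)` add up to at
least `1 / 2`, so convergence of the series for all thresholds forces the capacities themselves to
tend to zero, although `r - 2` may be negative. -/
theorem eventually_exceedSet_le {γ r : ℝ} (hγ : 0 < γ) (hr : 1 < r) {X : ℕ → Ω → ℝ}
    (hX : ∀ i, 1 ≤ i → X i ∈ S.H)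
    (hsum : ∀ b : ℝ, 0 < b →
      ∑' n : ℕ, ENNReal.ofReal ((n : ℝ) ^ (r - 2)) * S.nnE (ind (exceedSet X γ b n)) < ⊤) :
    ∀ᶠ n : ℕ in atTop, S.nnE (ind (exceedSet X γ 1 n)) ≤ ENNReal.ofReal (1 / 2) := by
  set F : ℕ → ℝ≥0∞ := fun n =>
    ENNReal.ofReal ((n : ℝ) ^ (r - 2)) * S.nnE (ind (exceedSet X γ (2 ^ (-γ)) n)) with hF
  have htail := ENNReal.tendsto_sum_nat_add F (hsum (2 ^ (-γ)) (by positivity)).ne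
  have hev := htail.eventually_le_const (u := ENNReal.ofReal (1 / 4)) (by simp)
  filter_upwards [hev, eventually_ge_atTop 1] with N hN hN1
  have hN0 : (0 : ℝ) < N := by exact_mod_cast hN1
  have hcomp : ∀ k ∈ Finset.range N, ENNReal.ofReal (1 / (2 * N)) *
      S.nnE (ind (exceedSet X γ 1 N)) ≤ F (k + N) := by
    intro k hk
    rw [Finset.mem_range] at hk
    have hk' : (k : ℝ) < N := by exact_mod_cast hk
    have hm1 : (1 : ℝ) ≤ ((k + N : ℕ) : ℝ) := by exact_mod_cast (by omega : 1 ≤ k + N)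
    have hm2 : ((k + N : ℕ) : ℝ) ≤ 2 * N := by push_cast; linarith
    refine mul_le_mul' (ENNReal.ofReal_le_ofReal ?_) (nnE_ind_mono (measurableSet_exceedSet hX _ _ _)
      (measurableSet_exceedSet hX _ _ _) ?_)
    · calc 1 / (2 * (N : ℝ)) ≤ ((k + N : ℕ) : ℝ) ^ (-1 : ℝ) := by
            rw [Real.rpow_neg_one, one_div]
            gcongr
        _ ≤ _ := Real.rpow_le_rpow_of_exponent_le hm1 (by linarith)
    · rintro ω ⟨i, hi, hlt⟩
      have hi' := Finset.mem_Icc.1 hi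
      have hi0 : (0 : ℝ) < i := by exact_mod_cast hi'.1
      refine ⟨i, Finset.Icc_subset_Icc_right (Nat.le_add_left N k) hi, lt_of_le_of_lt ?_ hlt⟩
      unfold wscale
      have h1 : (((k + N : ℕ) : ℝ) / i) ^ γ ≤ 2 ^ γ * ((N : ℝ) / i) ^ γ := by
        rw [← Real.mul_rpow (by norm_num) (by positivity), ← mul_div_assoc]
        gcongr
      calc (2 : ℝ) ^ (-γ) * (i * (((k + N : ℕ) : ℝ) / i) ^ γ)
          ≤ (2 : ℝ) ^ (-γ) * (i * (2 ^ γ * ((N : ℝ) / i) ^ γ)) := by gcongr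
        _ = ((2 : ℝ) ^ (-γ) * 2 ^ γ) * (i * ((N : ℝ) / i) ^ γ) := by ring
        _ = 1 * (i * ((N : ℝ) / i) ^ γ) := by
            rw [← Real.rpow_add (by norm_num), neg_add_cancel, Real.rpow_zero]
  have h1 : (N : ℝ≥0∞) * (ENNReal.ofReal (1 / (2 * N)) * S.nnE (ind (exceedSet X γ 1 N))) ≤
      ENNReal.ofReal (1 / 4) := by
    refine le_trans ?_ hN
    refine le_trans ?_ (ENNReal.sum_le_tsum (Finset.range N))
    have := Finset.card_nsmul_le_sum _ _ _ hcomp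
    rwa [Finset.card_range, nsmul_eq_mul] at this
  rw [← mul_assoc, ← ENNReal.ofReal_natCast, ← ENNReal.ofReal_mul hN0.le,
    show (N : ℝ) * (1 / (2 * N)) = 1 / 2 by field_simp] at h1
  have h2 : ENNReal.ofReal 2 * (ENNReal.ofReal (1 / 2) * S.nnE (ind (exceedSet X γ 1 N))) ≤
      ENNReal.ofReal 2 * ENNReal.ofReal (1 / 4) := by gcongr
  rw [← mul_assoc, ← ENNReal.ofReal_mul (by norm_num), ← ENNReal.ofReal_mul (by norm_num)] at h2
  norm_num at h2
  norm_num
  exact h2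

/-- If a union of independent events has capacity at most `1 / 2`, then the capacities of the events
add up to at most twice that capacity. -/
theorem sum_tail_le_two_mul {X₀ : Ω → ℝ} (hX₀ : X₀ ∈ S.H) {X : ℕ → Ω → ℝ}
    (hX : ∀ i, 1 ≤ i → X i ∈ S.H) (hindep : S.IndepSeq X)
    (hident : ∀ i, 1 ≤ i → S.IdentDistrib (X i) X₀) {γ : ℝ} {n : ℕ}
    (hsmall : S.nnE (ind (exceedSet X γ 1 n)) ≤ ENNReal.ofReal (1 / 2)) :
    ∑ i ∈ Finset.Icc 1 n, S.tail X₀ (1 * wscale γ n i) ≤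
      2 * S.nnE (ind (exceedSet X γ 1 n)) := by
  have hprod := hindep.nnE_ind_union hX (B := fun i => {y | 1 * wscale γ n i < |y|})
    (fun i => measurableSet_lt measurable_const _root_.measurable_abs) n
  have hfin : S.nnE (ind (exceedSet X γ 1 n)) ≠ ⊤ :=
    nnE_ind_ne_top (measurableSet_exceedSet hX _ _ _)
  set u : ℝ := (S.nnE (ind (exceedSet X γ 1 n))).toReal with hu
  have hset : (S.nnE (ind {ω | ∃ i ∈ Finset.Icc 1 n,
      X i ω ∈ {y | 1 * wscale γ n i < |y|}})).toReal = u := rfl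
  have htail : ∀ i ∈ Finset.Icc 1 n, (S.nnE (ind {ω | X i ω ∈ {y | 1 * wscale γ n i < |y|}})).toReal =
      (S.tail X₀ (1 * wscale γ n i)).toReal := fun i hi => by
    rw [Finset.mem_Icc] at hi
    rw [← (hident i hi.1).tail_eq (hX i hi.1) hX₀]
    rfl
  rw [hset, Finset.prod_congr rfl fun i hi => by rw [htail i hi]] at hprod
  set x : ℝ := ∑ i ∈ Finset.Icc 1 n, (S.tail X₀ (1 * wscale γ n i)).toReal with hx
  have hv1 : ∀ i, (S.tail X₀ (1 * wscale γ n i)).toReal ≤ 1 := fun i =>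
    ENNReal.toReal_le_of_le_ofReal zero_le_one (by simpa using tail_le_one hX₀ _)
  have hle : 1 - u ≤ Real.exp (-x) := by
    rw [hprod, hx, ← Finset.sum_neg_distrib, Real.exp_sum]
    refine Finset.prod_le_prod (fun i _ => sub_nonneg.2 (hv1 i)) fun i _ => ?_
    linarith [Real.add_one_le_exp (-(S.tail X₀ (1 * wscale γ n i)).toReal)]
  have hu2 : u ≤ 1 / 2 := ENNReal.toReal_le_of_le_ofReal (by norm_num) hsmall
  have hu0 : 0 ≤ u := ENNReal.toReal_nonneg
  have hx0 : 0 ≤ x := Finset.sum_nonneg fun i _ => ENNReal.toReal_nonneg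
  have hxu : x ≤ 2 * u := by
    -- `(1 - u) (1 + x) ≤ exp (-x) exp x = 1`
    have h1 : Real.exp (-x) * Real.exp x = 1 := by rw [← Real.exp_add]; simp
    have h2 := Real.add_one_le_exp x
    have h3 := mul_le_mul hle h2 (by linarith) (Real.exp_pos _).le
    rw [h1] at h3
    nlinarith
  have h4 : ∑ i ∈ Finset.Icc 1 n, S.tail X₀ (1 * wscale γ n i) = ENNReal.ofReal x := by
    rw [hx, ENNReal.ofReal_sum_of_nonneg fun i _ => ENNReal.toReal_nonneg]
    exact Finset.sum_congr rfl fun i _ => (ENNReal.ofReal_toReal (tail_ne_top hX₀ _)).symm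
  rw [h4, ← ENNReal.ofReal_toReal hfin, ← hu, ← ENNReal.ofReal_ofNat,
    ← ENNReal.ofReal_mul (by norm_num)]
  exact ENNReal.ofReal_le_ofReal hxu

/-- Convergence of the moment series for all `ε` implies the moment condition. -/
theorem lintegral_growth_lt_top_of_momentSeries {β r : ℝ} (hβ : -1 < β) (hr : 1 < r)
    {X₀ : Ω → ℝ} (hX₀ : X₀ ∈ S.H) {X : ℕ → Ω → ℝ} (hX : ∀ i, 1 ≤ i → X i ∈ S.H)
    (hindep : S.IndepSeq X) (hident : ∀ i, 1 ≤ i → S.IdentDistrib (X i) X₀)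
    {a : ℕ → ℕ → ℝ} (ha_pos : ∀ n i, 1 ≤ i → i ≤ n → 0 < a n i)
    (ha : ArrayLL (fun n i => ((i : ℝ) / (n : ℝ)) ^ β * (1 / (n : ℝ))) a)
    (hseries : ∀ ε : ℝ, 0 < ε → momentSeries S r a X ε < ⊤) :
    ∫⁻ x in Set.Ioi (0 : ℝ),
      S.nnE (ind {ω | x < growth ((r - 1) / (1 + β)) r |X₀ ω|}) < ⊤ := by
  have hγ : 0 < 1 + β := by linarith
  have hsum : ∀ b : ℝ, 0 < b → ∑' n : ℕ, ENNReal.ofReal ((n : ℝ) ^ (r - 2)) *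
      S.nnE (ind (exceedSet X (1 + β) b n)) < ⊤ := fun b hb =>
    tsum_exceedSet_lt_top hX ha_pos ha hseries hb
  obtain ⟨N, hN⟩ := eventually_atTop.1 (eventually_exceedSet_le hγ hr hX hsum)
  refine lintegral_growth_lt_top hX₀ hγ hr one_pos ?_
  have hrow : ∀ n : ℕ, ∑' i : ℕ, pairWeight r (n, i) * S.tail X₀ (1 * wscale (1 + β) n i) =
      ENNReal.ofReal ((n : ℝ) ^ (r - 2)) *
        ∑ i ∈ Finset.Icc 1 n, S.tail X₀ (1 * wscale (1 + β) n i) := fun n => by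
    rw [tsum_eq_sum (s := Finset.Icc 1 n), Finset.mul_sum]
    · exact Finset.sum_congr rfl fun i hi => by rw [pairWeight, if_pos (Finset.mem_Icc.1 hi)]
    · intro i hi
      rw [pairWeight, if_neg fun h => hi (Finset.mem_Icc.2 h), zero_mul]
  rw [ENNReal.tsum_prod']
  simp only [hrow]
  refine tsum_lt_top_of_le (Finset.range N)
    (g := fun n : ℕ => 2 * (ENNReal.ofReal ((n : ℝ) ^ (r - 2)) *
      S.nnE (ind (exceedSet X (1 + β) 1 n))))
    (fun n _ => ENNReal.mul_lt_top ENNReal.ofReal_lt_top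
      (ENNReal.sum_lt_top.2 fun i _ => (tail_ne_top hX₀ _).lt_top)) (fun n hn => ?_) ?_
  · rw [mul_left_comm]
    gcongr
    exact sum_tail_le_two_mul hX₀ hX hindep hident (hN n (by simpa using hn))
  · rw [ENNReal.tsum_mul_left]
    exact ENNReal.mul_lt_top ENNReal.ofNat_lt_top (hsum 1 one_pos)

end SublinearExpectationSpace

end

open SublinearExpectationSpace in
theorem theorem1 {Ω : Type*} [MeasurableSpace Ω] (S : SublinearExpectationSpace Ω)
    (hS : S.CountablySubadditive) (β r : ℝ) (hβ : -1 < β) (hr : 1 < r)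
    (X₀ : Ω → ℝ) (hX₀ : X₀ ∈ S.H) (X : ℕ → Ω → ℝ) (hX : ∀ i, 1 ≤ i → X i ∈ S.H)
    (hindep : S.IndepSeq X) (hident : ∀ i, 1 ≤ i → S.IdentDistrib (X i) X₀)
    (hmean : ∀ i, 1 ≤ i → S.E (X i) = 0 ∧ -S.E (fun ω => -X i ω) = 0)
    (a : ℕ → ℕ → ℝ) (ha_pos : ∀ n i, 1 ≤ i → i ≤ n → 0 < a n i)
    (ha_approx : ArrayApprox a (fun n i => ((i : ℝ) / (n : ℝ)) ^ β * (1 / (n : ℝ))))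
    (ha_sum : ∀ n, 1 ≤ n → ∑ i ∈ Finset.Icc 1 n, a n i = 1) :
    (S.MomentCondition β r X₀ →
      ∀ ε : ℝ, 0 < ε → momentSeries S r a X ε < ⊤ ∧ capacitySeries S r a X ε < ⊤) ∧
    ((∀ ε : ℝ, 0 < ε → momentSeries S r a X ε < ⊤) → S.MomentCondition β r X₀) := by
  have hiff := momentCondition_iff hβ hr hX₀
  refine ⟨fun hmom => ?_, fun hseries => hiff.2 ?_⟩
  · have hseries : ∀ ε : ℝ, 0 < ε → momentSeries S r a X ε < ⊤ := fun ε hε =>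
      momentSeries_lt_top hS hβ hr hX₀ hX hindep hident hmean ha_pos ha_approx.1 ha_sum
        (hiff.1 hmom) hε
    refine fun ε hε => ⟨hseries ε hε, ?_⟩
    have hcap := capacitySeries_lt_top hX (half_pos hε) (hseries _ (half_pos hε))
    rwa [mul_div_cancel₀ ε two_ne_zero] at hcap
  · exact lintegral_growth_lt_top_of_momentSeries hβ hr hX₀ hX hindep hident ha_pos ha_approx.2
      hseries
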